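/- Let $A_1,\dots,A_7$ be skew-symmetric real $8\times 8$ matrices with $A_iA_j+A_jA_i=-2\delta_{ij}I$. On the unit sphere $\mathbb S^7\subset\mathbb R^8$, where $T_q\mathbb S^7=q^\perp$, let $\mathcal D$ be one of the following distributions: - the trivializable distributions $\mathcal D_j(q)=\operatorname{span}\{A_1q,\dots,A_jq\}$ with $j=4,5,6$; - the Hopf distribution $\mathcal D_{\mathrm H}(q)=\operatorname{span}\{A_7q\}^\perp\cap T_q\mathbb S^7$ (which coincides with $\mathcal D_6$); - the quaternionic Hopf distribution $\mathcal D_{\mathrm{QH}}(q)=\operatorname{span}\{A_6q,A_7q,A_6A_7q\}^\perp\cap T_q\mathbb S^7$. Each carries the restriction of the round metric. Identify $T^*\mathbb S^7$ by the round metric with the submanifold $\{(q,\xi)\in\mathbb R^8\times\mathbb R^8:\ \|q\|=1,\ \langle q,\xi\rangle=0\}$, with its canonical symplectic form, the restriction of $\sum_i dq_i\wedge d\xi_i$. The subriemannian (SR) geodesic flow of $\mathcal D$ is the Hamiltonian flow of $H_{\mathrm{sub}}(q,\xi)=\tfrac12\|\mathrm{pr}_{\mathcal D(q)}\xi\|^2$,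 where $\mathrm{pr}_{\mathcal D(q)}$ is the orthogonal projection onto $\mathcal D(q)$. Functions on $T^*\mathbb S^7$ are called functionally independent if their differentials are linearly independent at every point of an open dense subset. **Theorem.** For each of these distributions the SR geodesic flow is completely integrable in the sense of Liouville: there are seven smooth, pairwise Poisson commuting, functionally independent functions $F_1,\dots,F_7$ on $T^*\mathbb S^7$ with $F_7=H_{\mathrm{sub}}$. Moreover, let $B(X,Y)=\operatorname{Tr}(X^TY)$ on $\mathfrak{so}(8)$, and let $P(q,\xi)=\tfrac12(\xi q^T-q\xi^T)$ be the momentum map $T^*\mathbb S^7\to\mathfrak{so}(8)^*\cong\mathfrak{so}(8)$, the identification being by $B$. For each of these distributions there is a strictly increasing chain $\mathfrak a_1\subset\dots\subset\mathfrak a_6\subset\mathfrak a_7=\mathfrak{so}(8)$ of $B$-non-degenerate Lie subalgebras with the following property. Let $\pi_i:\mathfrak{so}(8)\to\mathfrak a_i$ be the $B$-orthogonal projection and $f_i(X)=\tfrac12B(X,X)$ for $X\in\mathfrak a_i$. Then the seven functions $f_i\circ\pi_i\circ P$ are smooth, pairwise Poisson commuting, functionally independent first integrals of the SR geodesic flow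 (that is, they Poisson commute with $H_{\mathrm{sub}}$), and $H_{\mathrm{sub}}$ is a linear combination of them with constant real coefficients. -/

import Mathlib

open scoped Matrix ContDiff InnerProductSpace

-- Matrices carry the commutator bracket.
attribute [local instance] LieRing.ofAssociativeRing

noncomputable section

namespace SRSphere

/-- The ambient Euclidean space of the unit sphere `S^7`. -/
abbrev R8 : Type := EuclideanSpace ℝ (Fin 8)

/-- The linear action of an `8 × 8` matrix on `R^8`. -/
def act (M : Matrix (Fin 8) (Fin 8) ℝ) (q : R8) : R8 := WithLp.toLp 2 (M *ᵥ q.ofLp)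

/-! ### The symplectic manifold `T^*S^7` -/

/-- `T^*S^7`, identified with `TS^7` by the round metric: the submanifold of all
`(q, ξ) ∈ R^8 × R^8` with `‖q‖ = 1` and `⟪q, ξ⟫ = 0`; the pair `(q, ξ)` is the covector
`⟪ξ, ·⟫` on `T_q S^7`. -/
def cotangentSphere : Set (R8 × R8) := {x | ‖x.1‖ = 1 ∧ ⟪x.1, x.2⟫_ℝ = 0}

/-- The tangent space of `T^*S^7` at `x = (q, ξ)`: the kernel of the differential at `x` of the
two defining functions `‖q‖ ^ 2 / 2` and `⟪q, ξ⟫`. -/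
def tangentAt (x : cotangentSphere) : Submodule ℝ (R8 × R8) where
  carrier := {w | ⟪x.1.1, w.1⟫_ℝ = 0 ∧ ⟪w.1, x.1.2⟫_ℝ + ⟪x.1.1, w.2⟫_ℝ = 0}
  zero_mem' := by simp
  add_mem' := by
    rintro a b ⟨ha, ha'⟩ ⟨hb, hb'⟩
    refine ⟨?_, ?_⟩
    · simp only [Prod.fst_add, inner_add_right, ha, hb, add_zero]
    · simp only [Prod.fst_add, Prod.snd_add, inner_add_right, inner_add_left]
      linarith
  smul_mem' := by
    rintro c a ⟨ha, ha'⟩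
    refine ⟨?_, ?_⟩
    · simp only [Prod.smul_fst, inner_smul_right, ha, mul_zero]
    · simp only [Prod.smul_fst, Prod.smul_snd, inner_smul_right, real_inner_smul_left]
      rw [← mul_add, ha', mul_zero]

/-- `F` is a smooth function on `R^8 × R^8` that extends the function `f` on `T^*S^7`. -/
def IsSmoothExtension (f : cotangentSphere → ℝ) (F : R8 × R8 → ℝ) : Prop :=
  ContDiff ℝ ∞ F ∧ ∀ x : cotangentSphere, F x = f x

/-- Smooth functions on the closed embedded submanifold `T^*S^7`: the restrictions of smooth
functions on `R^8 × R^8`. -/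
def IsSmooth (f : cotangentSphere → ℝ) : Prop := ∃ F, IsSmoothExtension f F

open Classical in
/-- The differential of a smooth function at a point of `T^*S^7`, computed from a smooth extension
(by `differential_eq`, the choice of the extension does not matter); zero if `f` is not smooth. -/
def differential (f : cotangentSphere → ℝ) (x : cotangentSphere) :
    Module.Dual ℝ (tangentAt x) :=
  if h : IsSmooth f then (fderiv ℝ h.choose x.1).toLinearMap ∘ₗ (tangentAt x).subtype else 0

/-- Every tangent vector `w` at `x` is the velocity of a differentiable curve in `T^*S^7`. -/
theorem exists_curve (x : cotangentSphere) (w : R8 × R8) (hw : w ∈ tangentAt x) :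
    ∃ c : ℝ → R8 × R8, (∀ t, c t ∈ cotangentSphere) ∧ c 0 = x.1 ∧ HasDerivAt c w 0 := by
  obtain ⟨⟨q, ξ⟩, hq, hqξ⟩ := x
  obtain ⟨u, v⟩ := w
  obtain ⟨h1, h2⟩ := hw
  simp only at hq hqξ h1 h2
  have hqq : ⟪q, q⟫_ℝ = 1 := by rw [real_inner_self_eq_norm_sq, hq]; norm_num
  set N : ℝ → ℝ := fun t => ‖q + t • u‖ ^ 2 with hN
  have hNform : ∀ t, N t = 1 + t ^ 2 * ‖u‖ ^ 2 := by
    intro t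
    simp only [hN]
    rw [norm_add_sq_real, inner_smul_right, h1, hq, norm_smul, mul_pow, Real.norm_eq_abs, sq_abs]
    ring
  have hNpos : ∀ t, 0 < N t := by
    intro t
    rw [hNform]
    positivity
  have hc1 : HasDerivAt (fun t : ℝ => q + t • u) u 0 := by
    simpa using ((hasDerivAt_id (0 : ℝ)).smul_const u).const_add q
  have hc2 : HasDerivAt (fun t : ℝ => ξ + t • v) v 0 := by
    simpa using ((hasDerivAt_id (0 : ℝ)).smul_const v).const_add ξ
  have hNd : HasDerivAt N 0 0 := by
    have : HasDerivAt (fun t : ℝ => 1 + t ^ 2 * ‖u‖ ^ 2) 0 0 := by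
      simpa using (((hasDerivAt_pow 2 (0 : ℝ)).mul_const (‖u‖ ^ 2)).const_add 1)
    exact this.congr_of_eventuallyEq (Filter.Eventually.of_forall hNform)
  have hN0 : N 0 = 1 := by simp [hNform]
  have hs : HasDerivAt (fun t => (Real.sqrt (N t))⁻¹) 0 0 := by
    have h := (hNd.sqrt (hNpos 0).ne').inv (Real.sqrt_pos.2 (hNpos 0)).ne'
    exact h.congr_deriv (by simp)
  have hd : HasDerivAt (fun t => ⟪q + t • u, ξ + t • v⟫_ℝ / N t) 0 0 := by
    have h := (hc1.inner ℝ hc2).div hNd (hNpos 0).ne'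
    have e : ⟪q, v⟫_ℝ + ⟪u, ξ⟫_ℝ = 0 := by linarith
    exact h.congr_deriv (by simp [hN0, e])
  refine ⟨fun t => ((Real.sqrt (N t))⁻¹ • (q + t • u),
      (ξ + t • v) - (⟪q + t • u, ξ + t • v⟫_ℝ / N t) • (q + t • u)), ?_, ?_, ?_⟩
  · intro t
    have hn : Real.sqrt (N t) = ‖q + t • u‖ := by
      simp only [hN]
      exact Real.sqrt_sq (norm_nonneg _)
    have hpos : 0 < ‖q + t • u‖ := by rw [← hn]; exact Real.sqrt_pos.2 (hNpos t)
    refine ⟨?_, ?_⟩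
    · simp only [norm_smul, norm_inv, hn, norm_norm]
      exact inv_mul_cancel₀ hpos.ne'
    · simp only [real_inner_smul_left, inner_sub_right, inner_smul_right]
      rw [real_inner_self_eq_norm_sq, show ‖q + t • u‖ ^ 2 = N t from rfl,
        mul_left_comm, div_mul_cancel₀ _ (hNpos t).ne', sub_self]
  · simp [hN0, hqξ]
  · have ha := hs.smul hc1
    have hb := hc2.sub (hd.smul hc1)
    have := ha.prodMk hb
    simpa [hN0, hqξ] using this

/-- The differential may be computed from any smooth extension. -/
theorem differential_eq {f : cotangentSphere → ℝ} {F : R8 × R8 → ℝ} (hF : IsSmoothExtension f F)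
    (x : cotangentSphere) :
    differential f x = (fderiv ℝ F x.1).toLinearMap ∘ₗ (tangentAt x).subtype := by
  have h : IsSmooth f := ⟨F, hF⟩
  rw [differential, dif_pos h]
  ext w
  obtain ⟨c, hc, hc0, hcd⟩ := exists_curve x w.1 w.2
  have key : ∀ G : R8 × R8 → ℝ, IsSmoothExtension f G →
      HasDerivAt (fun t => f ⟨c t, hc t⟩) (fderiv ℝ G x.1 w.1) 0 := by
    intro G hG
    have hd : HasFDerivAt G (fderiv ℝ G x.1) (c 0) := by
      rw [hc0]
      exact (hG.1.differentiable (by simp) x.1).hasFDerivAt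
    have := hd.comp_hasDerivAt 0 hcd
    exact this.congr_of_eventuallyEq
      (Filter.Eventually.of_forall fun t => (hG.2 ⟨c t, hc t⟩).symm)
  exact (key _ h.choose_spec).unique (key _ hF)

/-- The canonical symplectic form `∑ dq_i ∧ dξ_i` of `T^*S^7` at the point `x`. -/
def symplecticForm (x : cotangentSphere) : LinearMap.BilinForm ℝ (tangentAt x) :=
  LinearMap.mk₂ ℝ (fun w w' => ⟪w.1.1, w'.1.2⟫_ℝ - ⟪w.1.2, w'.1.1⟫_ℝ)
    (by intro a b c; simp [inner_add_left]; ring)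
    (by intro c a b; simp [real_inner_smul_left]; ring)
    (by intro a b c; simp [inner_add_right]; ring)
    (by intro c a b; simp [inner_smul_right]; ring)

theorem symplecticForm_nondegenerate (x : cotangentSphere) :
    (symplecticForm x).Nondegenerate := by
  have hanti : ∀ a b, symplecticForm x a b = - symplecticForm x b a := by
    intro a b
    simp only [symplecticForm, LinearMap.mk₂_apply]
    rw [real_inner_comm a.1.1, real_inner_comm a.1.2]
    ring
  have hleft : ∀ a, (∀ b, symplecticForm x a b = 0) → a = 0 := by
    obtain ⟨⟨q, ξ⟩, hq, hqξ⟩ := x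
    rintro ⟨⟨u, v⟩, h1, h2⟩ h
    simp only at hq hqξ h1 h2
    have hqq : ⟪q, q⟫_ℝ = 1 := by rw [real_inner_self_eq_norm_sq, hq]; norm_num
    have hu : u = 0 := by
      have := h ⟨(0, u), by simp [tangentAt, h1]⟩
      simpa [symplecticForm] using this
    subst hu
    have hqv : ⟪q, v⟫_ℝ = 0 := by simpa using h2
    have hv : v = 0 := by
      have := h ⟨(v, -⟪v, ξ⟫_ℝ • q), by simp [tangentAt, hqv, inner_smul_right, hq]⟩
      simpa [symplecticForm] using this
    subst hv
    rfl
  refine ⟨hleft, fun a ha => hleft a fun b => ?_⟩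
  rw [hanti, ha b, neg_zero]

/-- The value at `x` of the Hamiltonian vector field `X_f`, i.e. the tangent vector with
`ω(X_f, ·) = df`. -/
def hamiltonianVector (f : cotangentSphere → ℝ) (x : cotangentSphere) : tangentAt x :=
  ((symplecticForm x).toDual (symplecticForm_nondegenerate x)).symm (differential f x)

/-- The Poisson bracket `{f, g} = ω(X_f, X_g)` on `T^*S^7`. -/
def poissonBracket (f g : cotangentSphere → ℝ) (x : cotangentSphere) : ℝ :=
  symplecticForm x (hamiltonianVector f x) (hamiltonianVector g x)

/-- Functional independence: the differentials are linearly independent at every point of an open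
dense subset of `T^*S^7`. -/
def FunctionallyIndependent {k : ℕ} (F : Fin k → cotangentSphere → ℝ) : Prop :=
  ∃ U : Set cotangentSphere, IsOpen U ∧ Dense U ∧
    ∀ x ∈ U, LinearIndependent ℝ fun i => differential (F i) x

/-- Complete integrability in the sense of Liouville of the Hamiltonian system on the
`14`-dimensional symplectic manifold `T^*S^7` with Hamiltonian `H`: there are `7` smooth,
Poisson commuting, functionally independent functions, the last of which is `H`. -/
def IsCompletelyIntegrable (H : cotangentSphere → ℝ) : Prop :=
  ∃ F : Fin 7 → cotangentSphere → ℝ, (∀ i, IsSmooth (F i)) ∧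
    (∀ i j x, poissonBracket (F i) (F j) x = 0) ∧ FunctionallyIndependent F ∧ F 6 = H

/-! ### The subriemannian structures -/

/-- A family of seven skew-symmetric `8 × 8` matrices with
`A_i A_j + A_j A_i = -2 δ_ij`; the matrix `A_i` is `A (i - 1)`. -/
def IsCliffordFamily (A : Fin 7 → Matrix (Fin 8) (Fin 8) ℝ) : Prop :=
  (∀ i, (A i)ᵀ = -A i) ∧ ∀ i j, A i * A j + A j * A i = if i = j then -2 else 0

/-- The trivializable distribution of rank `j`, `D_j(q) = span {A_1 q, …, A_j q}`. -/
def trivializable (A : Fin 7 → Matrix (Fin 8) (Fin 8) ℝ) (j : ℕ) (q : R8) : Submodule ℝ R8 :=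
  Submodule.span ℝ {v | ∃ i : Fin 7, (i : ℕ) < j ∧ v = act (A i) q}

/-- The horizontal distribution of the Hopf fibration: the orthogonal complement of
`span {A_7 q}` in `T_q S^7 = q^⊥`. -/
def hopf (A : Fin 7 → Matrix (Fin 8) (Fin 8) ℝ) (q : R8) : Submodule ℝ R8 :=
  (Submodule.span ℝ {q})ᗮ ⊓ (Submodule.span ℝ {act (A 6) q})ᗮ

/-- The horizontal distribution of the quaternionic Hopf fibration: the orthogonal complement of
`span {A_6 q, A_7 q, A_6 A_7 q}` in `T_q S^7 = q^⊥`. -/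
def quaternionicHopf (A : Fin 7 → Matrix (Fin 8) (Fin 8) ℝ) (q : R8) : Submodule ℝ R8 :=
  (Submodule.span ℝ {q})ᗮ ⊓
    (Submodule.span ℝ {act (A 5) q, act (A 6) q, act (A 5 * A 6) q})ᗮ

/-- The subriemannian Hamiltonian `½ g(β(p), β(p))` of the distribution `D` with the restricted
round metric. Here `β(p) ∈ D_q` is determined by `p(v) = g(β(p), v)` for `v ∈ D_q`; for the
covector `p = ⟪ξ, ·⟫` this is the orthogonal projection of `ξ` to `D_q`. -/
def srHamiltonian (D : R8 → Submodule ℝ R8) (x : cotangentSphere) : ℝ :=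
  ‖(D x.1.1).starProjection x.1.2‖ ^ 2 / 2

/-! ### The momentum map and functions from subalgebras of `so(8)` -/

/-- The Lie algebra `so(8)` of skew-symmetric matrices. -/
abbrev so8 : LieSubalgebra ℝ (Matrix (Fin 8) (Fin 8) ℝ) := LieAlgebra.Orthogonal.so (Fin 8) ℝ

/-- The bi-invariant inner product `B(X, Y) = Tr(Xᵀ Y)` on `so(8)`. -/
def formB : LinearMap.BilinForm ℝ so8 :=
  LinearMap.mk₂ ℝ (fun X Y => Matrix.trace ((X : Matrix (Fin 8) (Fin 8) ℝ)ᵀ * Y.1))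
    (by intro a b c; simp [add_mul])
    (by intro c a b; simp)
    (by intro a b c; simp [mul_add])
    (by intro c a b; simp)

/-- A subalgebra of `so(8)` is non-degenerate if the restriction of `B` to it is. -/
def IsNondegenerateSubalgebra (𝔞 : LieSubalgebra ℝ so8) : Prop :=
  (formB.restrict 𝔞.toSubmodule).Nondegenerate

theorem isNondegenerateSubalgebra (𝔞 : LieSubalgebra ℝ so8) : IsNondegenerateSubalgebra 𝔞 := by
  have hpos : ∀ X : so8, formB X X = 0 → X = 0 := by
    intro X hX
    have h : Matrix.trace ((X : Matrix (Fin 8) (Fin 8) ℝ)ᵀ * X.1) = 0 := hX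
    have := (Matrix.trace_conjTranspose_mul_self_eq_zero_iff (A := X.1)).1
      (by simpa [Matrix.conjTranspose_eq_transpose_of_trivial] using h)
    exact Subtype.ext this
  exact ⟨fun X h => Subtype.ext (hpos X.1 (h X)), fun X h => Subtype.ext (hpos X.1 (h X))⟩

/-- The orthogonal projection `π : so(8) → 𝔞` with respect to `B`: `π X` is the element of `𝔞`
with `B(π X, Y) = B(X, Y)` for all `Y ∈ 𝔞`. -/
def orthProj (𝔞 : LieSubalgebra ℝ so8) : so8 →ₗ[ℝ] 𝔞.toSubmodule :=
  ((formB.restrict 𝔞.toSubmodule).toDual (isNondegenerateSubalgebra 𝔞)).symm.toLinearMap ∘ₗ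
    (Submodule.dualRestrict 𝔞.toSubmodule) ∘ₗ formB

/-- The momentum map `P(q, ξ) = ½ (ξ qᵀ - q ξᵀ)` of the `SO(8)`-action on `T^*S^7`, with
`so(8)^*` identified with `so(8)` by `B`; thus `B(η, P(q, ξ)) = ⟪η q, ξ⟫`. -/
def momentumMap (x : cotangentSphere) : so8 :=
  ⟨(1 / 2 : ℝ) • (Matrix.vecMulVec x.1.2.ofLp x.1.1.ofLp - Matrix.vecMulVec x.1.1.ofLp x.1.2.ofLp),
    by
      rw [LieAlgebra.Orthogonal.mem_so, Matrix.transpose_smul, Matrix.transpose_sub,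
        Matrix.transpose_vecMulVec, Matrix.transpose_vecMulVec, ← smul_neg, neg_sub]⟩

/-- The function `f ∘ π ∘ P` on `T^*S^7`, where `π` is the orthogonal projection to the subalgebra
`𝔞` and `f(X) = ½ B(X, X)` is the bi-invariant quadratic function on `𝔞`. -/
def thimmFunction (𝔞 : LieSubalgebra ℝ so8) (x : cotangentSphere) : ℝ :=
  formB (orthProj 𝔞 (momentumMap x)).1 (orthProj 𝔞 (momentumMap x)).1 / 2

end SRSphere

end

/-!
The functions come from Thimm's construction. The Hamiltonian vector field of `½ B(π P, π P)`, where
`π` is the orthogonal projection to a subalgebra `𝔞` of `so(8)`, is the infinitesimal rotation by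
`π P` (`hamiltonianVector_thimm`), and invariance of `B` makes the functions of nested subalgebras
Poisson commute (`poissonBracket_thimm_of_le`). A Hamiltonian that is a linear combination of the
seven functions of a chain commutes with them and can take the place of one of them
(`isCompletelyIntegrable_of_eq_sum`). So it remains to find chains whose functions are independent
and have the subriemannian Hamiltonian in their span.

The subalgebras are spanned by bivectors. With `Γ_0 = 1` and `Γ_i = A_i`, the matrices
`½ (Γ_iᵀ Γ_j - Γ_jᵀ Γ_i)` satisfy the relations of the standard generators of `so(8)`, up to a
factor (`lie_biv`), and are orthogonal (`formB_biv`). Hence each partition of some of the indices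
`0, …, 7` into blocks yields a sum of orthogonal algebras, and an `so(4)` contains a `u(2)`, which
makes the chains long enough. As `A_i` is the bivector with indices `0` and `i`, and `A_6 A_7` is up
to sign the one with indices `6` and `7`, each of the Hamiltonians is a linear combination of the
functions of two such algebras.

For independence, differentials on vertical tangent vectors suffice. They give a determinant that is
a polynomial on `R^8 × R^8` and is, up to a nonzero factor, constant along a retraction to `T^*S^7`;
by the identity theorem it has to be nonzero at one point only (`functionallyIndependent_thimm`). To
have a point at which it can be computed for every family `A_i`, one uses that up to signs the `A_i`
are the left multiplications by the octonion units in a suitable orthonormal basis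
(`IsCliffordFamily.exists_octonionFrame`). In these coordinates explicit integer vectors make the
matrix diagonal.
-/

noncomputable section

namespace SRSphere

/-- The momentum map `P(q, ξ) = ½ (ξ qᵀ - q ξᵀ)` as a bilinear map on all of `R^8 × R^8`. -/
def momentum : R8 →ₗ[ℝ] R8 →ₗ[ℝ] so8 :=
  LinearMap.mk₂ ℝ (fun q ξ => ⟨(1 / 2 : ℝ) •
      (Matrix.vecMulVec ξ.ofLp q.ofLp - Matrix.vecMulVec q.ofLp ξ.ofLp), by
    rw [LieAlgebra.Orthogonal.mem_so, Matrix.transpose_smul, Matrix.transpose_sub,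
      Matrix.transpose_vecMulVec, Matrix.transpose_vecMulVec, ← smul_neg, neg_sub]⟩)
    (by intro a b c; ext i j; simp [Matrix.vecMulVec_apply]; ring)
    (by intro a b c; ext i j; simp [Matrix.vecMulVec_apply]; ring)
    (by intro a b c; ext i j; simp [Matrix.vecMulVec_apply]; ring)
    (by intro a b c; ext i j; simp [Matrix.vecMulVec_apply]; ring)

theorem momentumMap_eq (x : cotangentSphere) : momentumMap x = momentum x.1.1 x.1.2 := rfl

theorem momentum_self (q : R8) : momentum q q = 0 := by
  ext i j; simp [momentum]

theorem formB_comm (X Y : so8) : formB X Y = formB Y X := by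
  simp only [formB, LinearMap.mk₂_apply]
  rw [← Matrix.trace_transpose, Matrix.transpose_mul, Matrix.transpose_transpose]

theorem formB_eq_sum (X Y : so8) : formB X Y = ∑ i, ∑ j, X.1 j i * Y.1 j i := by
  simp [formB, Matrix.trace, Matrix.mul_apply]

theorem transpose_coe (X : so8) : X.1ᵀ = -X.1 := (LieAlgebra.Orthogonal.mem_so _ _ _).1 X.2

/-- Invariance of `B` under the adjoint action. -/
theorem formB_lie (X Y Z : so8) : formB ⁅X, Y⁆ Z = formB X ⁅Y, Z⁆ := by
  simp only [formB, LinearMap.mk₂_apply, LieSubalgebra.coe_bracket, Ring.lie_def, transpose_coe,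
    mul_sub, sub_mul, neg_mul, Matrix.trace_sub, Matrix.trace_neg, mul_assoc]
  rw [Matrix.trace_mul_comm X.1 (Z.1 * Y.1), mul_assoc, Matrix.trace_mul_comm Z.1 (Y.1 * X.1),
    mul_assoc]

theorem formB_lie_self (X Y : so8) : formB ⁅X, Y⁆ Y = 0 := by
  rw [formB_lie, lie_self, map_zero]

theorem inner_eq_dotProduct (u v : R8) : ⟪u, v⟫_ℝ = u.ofLp ⬝ᵥ v.ofLp := by
  rw [EuclideanSpace.inner_eq_star_dotProduct, star_trivial, dotProduct_comm]

theorem inner_act_left (M : Matrix (Fin 8) (Fin 8) ℝ) (q ξ : R8) :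
    ⟪act M q, ξ⟫_ℝ = ⟪q, act Mᵀ ξ⟫_ℝ := by
  simp only [act, inner_eq_dotProduct]
  rw [Matrix.mulVec_transpose, dotProduct_comm, Matrix.dotProduct_mulVec, dotProduct_comm]

theorem act_neg (M : Matrix (Fin 8) (Fin 8) ℝ) (q : R8) : act (-M) q = -act M q := by
  ext i; simp [act, Matrix.neg_mulVec]

theorem act_sub (M N : Matrix (Fin 8) (Fin 8) ℝ) (q : R8) :
    act (M - N) q = act M q - act N q := by
  ext i; simp [act, Matrix.sub_mulVec]

theorem act_mul (M N : Matrix (Fin 8) (Fin 8) ℝ) (q : R8) :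
    act (M * N) q = act M (act N q) := by
  ext i; simp [act]

theorem inner_act_skew (X : so8) (q ξ : R8) : ⟪act X.1 q, ξ⟫_ℝ = -⟪q, act X.1 ξ⟫_ℝ := by
  rw [inner_act_left, transpose_coe, act_neg, inner_neg_right]

/-- The defining property of the momentum map: `B(Z, P(q, ξ))` is the Hamiltonian `⟪Z q, ξ⟫` of the
one-parameter group generated by `Z`. -/
theorem formB_momentum (Z : so8) (q ξ : R8) : formB Z (momentum q ξ) = ⟪act Z.1 q, ξ⟫_ℝ := by
  have h : formB Z (momentum q ξ) =
      (1 / 2 : ℝ) * (⟪act Z.1 q, ξ⟫_ℝ - ⟪act Z.1 ξ, q⟫_ℝ) := by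
    simp only [formB, LinearMap.mk₂_apply, momentum, Matrix.mul_smul, Matrix.trace_smul,
      smul_eq_mul, Matrix.mul_sub, Matrix.trace_sub, Matrix.mul_vecMulVec, Matrix.trace_vecMulVec,
      transpose_coe, Matrix.neg_mulVec, neg_dotProduct, inner_eq_dotProduct, act]
    ring
  rw [h, inner_act_skew Z ξ q, real_inner_comm]
  ring

theorem orthProj_mem (𝔞 : LieSubalgebra ℝ so8) (X : so8) : (orthProj 𝔞 X).1 ∈ 𝔞 :=
  (orthProj 𝔞 X).2

theorem formB_orthProj (𝔞 : LieSubalgebra ℝ so8) (X Y : so8) (hY : Y ∈ 𝔞) :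
    formB (orthProj 𝔞 X).1 Y = formB X Y := by
  have := LinearMap.BilinForm.apply_toDual_symm_apply (hB := isNondegenerateSubalgebra 𝔞)
    ((Submodule.dualRestrict 𝔞.toSubmodule) (formB X)) ⟨Y, hY⟩
  exact this

theorem formB_self_eq_zero {X : so8} (h : formB X X = 0) : X = 0 := by
  rw [formB_eq_sum] at h
  ext i j
  have h1 := (Finset.sum_eq_zero_iff_of_nonneg fun i _ =>
    Finset.sum_nonneg fun j _ => mul_self_nonneg (X.1 j i)).1 h j (Finset.mem_univ _)
  have h2 := (Finset.sum_eq_zero_iff_of_nonneg fun i _ => mul_self_nonneg (X.1 i j)).1 h1 i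
    (Finset.mem_univ _)
  simpa using h2

/-- The defining property of the orthogonal projection determines it. -/
theorem orthProj_eq {𝔞 : LieSubalgebra ℝ so8} {X Z : so8} (hZ : Z ∈ 𝔞)
    (h : ∀ Y ∈ 𝔞, formB Z Y = formB X Y) : (orthProj 𝔞 X).1 = Z := by
  rw [← sub_eq_zero]
  have hm : (orthProj 𝔞 X).1 - Z ∈ 𝔞 := sub_mem (orthProj_mem 𝔞 X) hZ
  apply formB_self_eq_zero
  rw [LinearMap.map_sub₂, h _ hm, formB_orthProj _ _ _ hm, sub_self]

theorem orthProj_top (X : so8) : (orthProj ⊤ X).1 = X :=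
  orthProj_eq (LieSubalgebra.mem_top _) fun _ _ => rfl

theorem formB_orthProj_orthProj (𝔞 : LieSubalgebra ℝ so8) (X Y : so8) :
    formB (orthProj 𝔞 X).1 (orthProj 𝔞 Y).1 = formB (orthProj 𝔞 X).1 Y := by
  rw [formB_comm, formB_orthProj _ _ _ (orthProj_mem 𝔞 X), formB_comm]

/-! ### The functions of subalgebras and their Poisson brackets -/

/-- The function `½ B(π P, π P)` on all of `R^8 × R^8`, where `π` is the orthogonal projection to
`𝔞`: a quartic polynomial that extends `thimmFunction 𝔞`. -/
def thimmExt (𝔞 : LieSubalgebra ℝ so8) (y : R8 × R8) : ℝ :=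
  formB (orthProj 𝔞 (momentum y.1 y.2)).1 (orthProj 𝔞 (momentum y.1 y.2)).1 / 2

theorem contDiff_bilinear {n : WithTop ℕ∞} (β : R8 →ₗ[ℝ] R8 →ₗ[ℝ] ℝ) {f g : R8 × R8 → R8}
    (hf : ContDiff ℝ n f) (hg : ContDiff ℝ n g) : ContDiff ℝ n fun y => β (f y) (g y) := by
  let L : R8 →L[ℝ] R8 →L[ℝ] ℝ :=
    (LinearMap.toContinuousLinearMap.toLinearMap ∘ₗ β).toContinuousLinearMap
  exact (L.contDiff.comp hf).clm_apply hg

/-- The `(i, j)` entry of the matrix `π P(q, ξ)`, where `π` is the orthogonal projection to `𝔞`, as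
a bilinear form in `(q, ξ)`. -/
def projEntry (𝔞 : LieSubalgebra ℝ so8) (i j : Fin 8) : R8 →ₗ[ℝ] R8 →ₗ[ℝ] ℝ :=
  momentum.compr₂ ((Matrix.entryLinearMap ℝ ℝ i j) ∘ₗ so8.toSubmodule.subtype ∘ₗ
    𝔞.toSubmodule.subtype ∘ₗ orthProj 𝔞)

theorem projEntry_apply (𝔞 : LieSubalgebra ℝ so8) (i j : Fin 8) (q ξ : R8) :
    projEntry 𝔞 i j q ξ = (orthProj 𝔞 (momentum q ξ)).1.1 i j := rfl

theorem thimmExt_eq_sum (𝔞 : LieSubalgebra ℝ so8) :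
    thimmExt 𝔞 = fun y => (∑ i, ∑ j, projEntry 𝔞 j i y.1 y.2 * projEntry 𝔞 j i y.1 y.2) / 2 := by
  ext y
  rw [thimmExt, formB_eq_sum]
  rfl

theorem isSmoothExtension_thimm (𝔞 : LieSubalgebra ℝ so8) :
    IsSmoothExtension (thimmFunction 𝔞) (thimmExt 𝔞) := by
  refine ⟨?_, fun x => rfl⟩
  rw [thimmExt_eq_sum]
  refine ContDiff.div_const (ContDiff.sum fun i _ => ContDiff.sum fun j _ => ?_) _
  exact (contDiff_bilinear _ contDiff_fst contDiff_snd).mul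
    (contDiff_bilinear _ contDiff_fst contDiff_snd)

theorem hasFDerivAt_bilinear (β : R8 →ₗ[ℝ] R8 →ₗ[ℝ] ℝ) (y : R8 × R8) :
    ∃ L : R8 × R8 →L[ℝ] ℝ, HasFDerivAt (fun y : R8 × R8 => β y.1 y.2) L y ∧
      ∀ w, L w = β y.1 w.2 + β w.1 y.2 := by
  let L : R8 →L[ℝ] R8 →L[ℝ] ℝ :=
    (LinearMap.toContinuousLinearMap.toLinearMap ∘ₗ β).toContinuousLinearMap
  exact ⟨_, L.hasFDerivAt_of_bilinear hasFDerivAt_fst hasFDerivAt_snd, fun w => rfl⟩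

theorem fderiv_thimmExt (𝔞 : LieSubalgebra ℝ so8) (y w : R8 × R8) :
    fderiv ℝ (thimmExt 𝔞) y w = formB (orthProj 𝔞 (momentum y.1 y.2)).1
      (momentum y.1 w.2 + momentum w.1 y.2) := by
  choose L hL hLw using fun i j => hasFDerivAt_bilinear (projEntry 𝔞 j i) y
  have h := (HasFDerivAt.fun_sum (u := Finset.univ) fun i _ => HasFDerivAt.fun_sum
    (u := Finset.univ) fun j _ => (hL i j).mul (hL i j)).mul_const (2⁻¹ : ℝ)
  replace h := h.congr_of_eventuallyEq (f₁ := thimmExt 𝔞) (Filter.Eventually.of_forall fun z => by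
    rw [thimmExt_eq_sum]
    exact div_eq_mul_inv _ _)
  rw [h.fderiv, ← formB_orthProj_orthProj, formB_eq_sum]
  simp only [_root_.smul_apply, _root_.sum_apply,
    _root_.add_apply, hLw, smul_eq_mul, Finset.mul_sum]
  refine Finset.sum_congr rfl fun i _ => Finset.sum_congr rfl fun j _ => ?_
  simp only [projEntry_apply, map_add, AddMemClass.coe_add, Matrix.add_apply]
  ring

theorem differential_thimm (𝔞 : LieSubalgebra ℝ so8) (x : cotangentSphere) (w : tangentAt x) :
    differential (thimmFunction 𝔞) x w = formB (orthProj 𝔞 (momentumMap x)).1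
      (momentum x.1.1 w.1.2 + momentum w.1.1 x.1.2) := by
  rw [differential_eq (isSmoothExtension_thimm 𝔞)]
  exact fderiv_thimmExt 𝔞 x.1 w.1

/-- The vector field `(q, ξ) ↦ (Z q, Z ξ)` on `T^*S^7` generated by `Z ∈ so(8)`. -/
def rotationField (Z : so8) (x : cotangentSphere) : tangentAt x :=
  ⟨(act Z.1 x.1.1, act Z.1 x.1.2), by
    have h := inner_act_skew Z
    refine ⟨?_, ?_⟩
    · have h1 := h x.1.1 x.1.1
      rw [real_inner_comm] at h1
      simp only
      linarith
    · simp only [h x.1.1 x.1.2]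
      ring⟩

theorem symplecticForm_apply (x : cotangentSphere) (w w' : tangentAt x) :
    symplecticForm x w w' = ⟪w.1.1, w'.1.2⟫_ℝ - ⟪w.1.2, w'.1.1⟫_ℝ := rfl

theorem symplecticForm_hamiltonianVector (f : cotangentSphere → ℝ) (x : cotangentSphere)
    (w : tangentAt x) : symplecticForm x (hamiltonianVector f x) w = differential f x w :=
  LinearMap.BilinForm.apply_toDual_symm_apply _ _

theorem poissonBracket_eq (f g : cotangentSphere → ℝ) (x : cotangentSphere) :
    poissonBracket f g x = differential f x (hamiltonianVector g x) :=
  symplecticForm_hamiltonianVector _ _ _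

/-- The Hamiltonian vector field of `½ B(π P, π P)` at `x` is the infinitesimal rotation by the
matrix `π P(x)`. -/
theorem hamiltonianVector_thimm (𝔞 : LieSubalgebra ℝ so8) (x : cotangentSphere) :
    hamiltonianVector (thimmFunction 𝔞) x = rotationField (orthProj 𝔞 (momentumMap x)).1 x := by
  rw [hamiltonianVector, LinearEquiv.symm_apply_eq]
  ext w
  rw [LinearMap.BilinForm.toDual_def, symplecticForm_apply, differential_thimm, map_add,
    formB_momentum, formB_momentum, inner_act_skew _ w.1.1, rotationField, real_inner_comm w.1.1]
  ring

/-- With `Z = π_𝔞 P(x)` and `Y = π_𝔟 P(x)` the Poisson bracket is `B([Z, Y], P(x))`, the momentum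
map being equivariant. -/
theorem poissonBracket_thimm (𝔞 𝔟 : LieSubalgebra ℝ so8) (x : cotangentSphere) :
    poissonBracket (thimmFunction 𝔞) (thimmFunction 𝔟) x =
      formB ⁅(orthProj 𝔞 (momentumMap x)).1, (orthProj 𝔟 (momentumMap x)).1⁆ (momentumMap x) := by
  rw [poissonBracket, hamiltonianVector_thimm, hamiltonianVector_thimm, symplecticForm_apply,
    momentumMap_eq, formB_momentum]
  set Z := (orthProj 𝔞 (momentum x.1.1 x.1.2)).1
  set Y := (orthProj 𝔟 (momentum x.1.1 x.1.2)).1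
  simp only [rotationField, LieSubalgebra.coe_bracket, Ring.lie_def, act_sub, act_mul,
    inner_sub_left, inner_act_skew Z (act Y.1 _), inner_act_skew Y (act Z.1 _)]
  rw [real_inner_comm (act Y.1 x.1.1)]
  ring

/-- Functions of nested subalgebras Poisson commute: if `𝔞 ≤ 𝔟` then `[Z, Y] ∈ 𝔟`, so that
`B([Z, Y], P) = B([Z, Y], Y)`, and this vanishes because `B` is invariant. -/
theorem poissonBracket_thimm_of_le {𝔞 𝔟 : LieSubalgebra ℝ so8} (h : 𝔞 ≤ 𝔟)
    (x : cotangentSphere) :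
    poissonBracket (thimmFunction 𝔞) (thimmFunction 𝔟) x = 0 := by
  rw [poissonBracket_thimm, formB_comm, ← formB_orthProj, formB_comm, formB_lie_self]
  exact 𝔟.lie_mem (h (orthProj_mem _ _)) (orthProj_mem _ _)

theorem poissonBracket_swap (f g : cotangentSphere → ℝ) (x : cotangentSphere) :
    poissonBracket f g x = -poissonBracket g f x := by
  rw [poissonBracket, poissonBracket, symplecticForm_apply, symplecticForm_apply,
    real_inner_comm, real_inner_comm (hamiltonianVector g x).1.1]
  ring

theorem poissonBracket_thimm_chain {𝔞 : Fin 7 → LieSubalgebra ℝ so8} (h : Monotone 𝔞)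
    (i j : Fin 7) (x : cotangentSphere) :
    poissonBracket (thimmFunction (𝔞 i)) (thimmFunction (𝔞 j)) x = 0 := by
  rcases le_total i j with hij | hij
  · exact poissonBracket_thimm_of_le (h hij) x
  · rw [poissonBracket_swap, poissonBracket_thimm_of_le (h hij) x, neg_zero]

theorem isSmooth_thimm (𝔞 : LieSubalgebra ℝ so8) : IsSmooth (thimmFunction 𝔞) :=
  ⟨_, isSmoothExtension_thimm 𝔞⟩

/-! ### Linear combinations of functions in involution -/

section LinearCombination

variable {F : Fin 7 → cotangentSphere → ℝ} {H : cotangentSphere → ℝ} {c : Fin 7 → ℝ}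

theorem isSmooth_and_differential_of_eq_sum (hF : ∀ i, IsSmooth (F i))
    (hH : ∀ x, H x = ∑ i, c i * F i x) :
    IsSmooth H ∧ ∀ x, differential H x = ∑ i, c i • differential (F i) x := by
  choose G hG using hF
  have hE : IsSmoothExtension H fun y => ∑ i, c i * G i y := by
    refine ⟨ContDiff.sum fun i _ => contDiff_const.mul (hG i).1, fun x => ?_⟩
    rw [hH]
    exact Finset.sum_congr rfl fun i _ => by rw [(hG i).2]
  refine ⟨⟨_, hE⟩, fun x => ?_⟩
  have hd : HasFDerivAt (fun y => ∑ i, c i * G i y) (∑ i, c i • fderiv ℝ (G i) x.1) x.1 :=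
    HasFDerivAt.fun_sum fun i _ =>
      (((hG i).1.differentiable (by simp) x.1).hasFDerivAt).const_mul (c i)
  rw [differential_eq hE, hd.fderiv]
  ext w
  simp [differential_eq (hG _)]

theorem poissonBracket_eq_zero_of_eq_sum (hF : ∀ i, IsSmooth (F i))
    (hFF : ∀ i j x, poissonBracket (F i) (F j) x = 0) (hH : ∀ x, H x = ∑ i, c i * F i x)
    (i : Fin 7) (x : cotangentSphere) : poissonBracket (F i) H x = 0 := by
  rw [poissonBracket_swap, poissonBracket_eq, (isSmooth_and_differential_of_eq_sum hF hH).2]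
  simp only [LinearMap.sum_apply, LinearMap.smul_apply, ← poissonBracket_eq, hFF, smul_zero,
    Finset.sum_const_zero, neg_zero]

/-- The exchange lemma: a vector `v k` of a linearly independent family may be replaced by a linear
combination in which it occurs. -/
theorem LinearIndependent.update_sum {V ι : Type*} [AddCommGroup V] [Module ℝ V] [Fintype ι]
    [DecidableEq ι] {v : ι → V} (hv : LinearIndependent ℝ v) {c : ι → ℝ} {k : ι} (hk : c k ≠ 0) :
    LinearIndependent ℝ (Function.update v k (∑ i, c i • v i)) := by
  rw [Fintype.linearIndependent_iff] at hv ⊢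
  intro g hg
  have key : ∑ i, (g k * c i + if i = k then 0 else g i) • v i = 0 := by
    rw [← hg, ← Finset.add_sum_erase _ _ (Finset.mem_univ k), ← Finset.add_sum_erase
      (f := fun i => g i • _) _ (Finset.mem_univ k), Function.update_self, Finset.smul_sum,
      ← Finset.add_sum_erase _ _ (Finset.mem_univ k), add_assoc, ← Finset.sum_add_distrib]
    simp only [if_true, add_zero, smul_smul]
    congr 1
    refine Finset.sum_congr rfl fun i hi => ?_
    have hi := Finset.ne_of_mem_erase hi
    rw [if_neg hi, Function.update_of_ne hi, add_smul]
  have h0 := hv _ key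
  have hgk : g k = 0 := by simpa [hk] using h0 k
  intro i
  by_cases hi : i = k
  · rw [hi, hgk]
  · simpa [hgk, hi] using h0 i

/-- If `H` is a linear combination of seven independent functions in involution, then it may take
the place of one that occurs in it; so `H` is completely integrable. -/
theorem isCompletelyIntegrable_of_eq_sum (hF : ∀ i, IsSmooth (F i))
    (hFF : ∀ i j x, poissonBracket (F i) (F j) x = 0) (hI : FunctionallyIndependent F)
    (hH : ∀ x, H x = ∑ i, c i * F i x) {k : Fin 7} (hk : c k ≠ 0) :
    IsCompletelyIntegrable H := by
  have hHs := isSmooth_and_differential_of_eq_sum hF hH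
  have hFH := poissonBracket_eq_zero_of_eq_sum hF hFF hH
  have hcases : ∀ (P : (cotangentSphere → ℝ) → Prop), (∀ i, P (F i)) → P H →
      ∀ i, P (Function.update F k H i) := fun P hP hPH i => by
    by_cases hi : i = k
    · rw [hi, Function.update_self]; exact hPH
    · rw [Function.update_of_ne hi]; exact hP i
  -- The transposition puts `H`, which replaces `F k`, at the last place.
  refine ⟨fun i => Function.update F k H (Equiv.swap k 6 i), fun i => hcases _ hF hHs.1 _,
    fun i j x => ?_, ?_, ?_⟩
  · refine hcases (fun f => poissonBracket f _ x = 0) (fun i => ?_) ?_ _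
    · exact hcases (fun f => poissonBracket _ f x = 0) (fun j => hFF i j x) (hFH i x) _
    · refine hcases (fun f => poissonBracket _ f x = 0) (fun j => ?_) ?_ _
      · rw [poissonBracket_swap, hFH, neg_zero]
      · have := poissonBracket_swap H H x
        linarith
  · obtain ⟨U, hU, hUd, hUI⟩ := hI
    refine ⟨U, hU, hUd, fun x hx => ?_⟩
    have h := (LinearIndependent.update_sum (hUI x hx) hk).comp _ (Equiv.swap k 6).injective
    have e : (fun i => differential (Function.update F k H (Equiv.swap k 6 i)) x) =
        Function.update (fun i => differential (F i) x) k (∑ i, c i • differential (F i) x) ∘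
          Equiv.swap k 6 := by
      ext1 i
      rw [Function.comp_apply, ← hHs.2 x]
      exact (Function.apply_update (fun _ f => differential f x) F k H _)
    rw [e]
    exact h
  · change Function.update F k H (Equiv.swap k 6 6) = H
    rw [Equiv.swap_apply_right, Function.update_self]

end LinearCombination

/-! ### Functional independence from one point -/

/-- The matrix `B(π_i P(q, ξ), P(q, v_k))`, where `π_i` is the orthogonal projection to `𝔞 i`. On
`T^*S^7` its entries are the values of the differentials of the functions `thimmFunction (𝔞 i)` on
the vertical tangent vectors `(0, v_k - ⟪q, v_k⟫ q)`. It makes sense on all of `R^8 × R^8`. -/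
def thimmPairing (𝔞 : Fin 7 → LieSubalgebra ℝ so8) (v : Fin 7 → R8) (y : R8 × R8) :
    Matrix (Fin 7) (Fin 7) ℝ :=
  Matrix.of fun i k => formB (orthProj (𝔞 i) (momentum y.1 y.2)).1 (momentum y.1 (v k))

/-- The determinant is a polynomial; with `n = ω` this says that it is analytic. -/
theorem contDiff_det_thimmPairing {n : WithTop ℕ∞} (𝔞 : Fin 7 → LieSubalgebra ℝ so8)
    (v : Fin 7 → R8) : ContDiff ℝ n fun y => (thimmPairing 𝔞 v y).det := by
  simp only [Matrix.det_apply']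
  refine ContDiff.sum fun σ _ => contDiff_const.mul (contDiff_prod fun i _ => ?_)
  have h : ∀ y : R8 × R8, thimmPairing 𝔞 v y (σ i) i = ∑ a, ∑ b,
      projEntry (𝔞 (σ i)) b a y.1 y.2 * projEntry (𝔞 (σ i)) b a y.1 (v i) := fun y => by
    rw [thimmPairing, Matrix.of_apply, ← formB_orthProj_orthProj, formB_eq_sum]
    rfl
  simp only [h]
  refine ContDiff.sum fun a _ => ContDiff.sum fun b _ => ?_
  exact (contDiff_bilinear (projEntry (𝔞 (σ i)) b a) contDiff_fst contDiff_snd).mul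
    (contDiff_bilinear (projEntry (𝔞 (σ i)) b a) contDiff_fst contDiff_const)

/-- A nonzero minor of the differentials on vertical vectors makes them independent. The component
`⟪q, v_k⟫ q` does not contribute, since `P(q, q) = 0`. -/
theorem linearIndependent_differential_thimm (𝔞 : Fin 7 → LieSubalgebra ℝ so8) (v : Fin 7 → R8)
    (x : cotangentSphere) (h : (thimmPairing 𝔞 v x.1).det ≠ 0) :
    LinearIndependent ℝ fun i => differential (thimmFunction (𝔞 i)) x := by
  obtain ⟨⟨q, ξ⟩, hq, hqξ⟩ := x
  rw [Fintype.linearIndependent_iff]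
  intro a ha
  refine congrFun (Matrix.eq_zero_of_vecMul_eq_zero h ?_)
  ext k
  have hq1 : ‖q‖ = 1 := hq
  -- The vertical lift of the tangential part of `v k`.
  have hw : ((0 : R8), v k - ⟪q, v k⟫_ℝ • q) ∈ tangentAt ⟨(q, ξ), hq, hqξ⟩ :=
    ⟨by simp, by simp [inner_sub_right, inner_smul_right, hq1]⟩
  have := congrArg (fun L => L ⟨_, hw⟩) ha
  simpa [LinearMap.sum_apply, differential_thimm, momentum_self, Matrix.vecMul, dotProduct,
    thimmPairing, momentumMap_eq] using this

/-- The map `(q, ξ) ↦ (q / ‖q‖, ξ - ⟪q, ξ⟫ q / ‖q‖²)`, a retraction of `{q ≠ 0}` onto `T^*S^7`. -/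
def retraction (y : R8 × R8) : R8 × R8 :=
  (‖y.1‖⁻¹ • y.1, y.2 - (⟪y.1, y.2⟫_ℝ / ‖y.1‖ ^ 2) • y.1)

theorem retraction_mem {y : R8 × R8} (hy : y.1 ≠ 0) : retraction y ∈ cotangentSphere := by
  have hn : ‖y.1‖ ≠ 0 := norm_ne_zero_iff.2 hy
  refine ⟨by simp [retraction, norm_smul, hn], ?_⟩
  simp only [retraction, real_inner_smul_left, inner_sub_right, inner_smul_right,
    real_inner_self_eq_norm_sq]
  field_simp
  ring

theorem retraction_of_mem {y : R8 × R8} (hy : y ∈ cotangentSphere) : retraction y = y := by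
  obtain ⟨h1, h2⟩ := hy
  simp [retraction, h1, h2]

/-- The pairing depends on `ξ` only modulo `q`, and it is homogeneous in `q`; so up to a nonzero
factor it is constant along the retraction. -/
theorem thimmPairing_retraction (𝔞 : Fin 7 → LieSubalgebra ℝ so8) (v : Fin 7 → R8)
    (y : R8 × R8) :
    thimmPairing 𝔞 v (retraction y) = (‖y.1‖⁻¹ * ‖y.1‖⁻¹) • thimmPairing 𝔞 v y := by
  ext i k
  simp [thimmPairing, retraction, momentum_self]
  ring

theorem continuousAt_retraction {y : R8 × R8} (hy : y.1 ≠ 0) : ContinuousAt retraction y := by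
  have hn : ‖y.1‖ ≠ 0 := norm_ne_zero_iff.2 hy
  have hn2 : ‖y.1‖ ^ 2 ≠ 0 := pow_ne_zero _ hn
  unfold retraction
  refine ContinuousAt.prodMk ?_ ?_
  · exact (continuous_fst.norm.continuousAt.inv₀ hn).smul continuous_fst.continuousAt
  · have h1 : Continuous fun y : R8 × R8 => ⟪y.1, y.2⟫_ℝ := continuous_fst.inner continuous_snd
    have h2 : Continuous fun y : R8 × R8 => ‖y.1‖ ^ 2 := continuous_fst.norm.pow 2
    have h3 := h1.continuousAt.div h2.continuousAt hn2
    exact continuous_snd.continuousAt.sub (h3.smul continuous_fst.continuousAt)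

/-- Functional independence follows from a single point `y₀` of `R^8 × R^8`, not necessarily on
`T^*S^7`, at which the determinant of the pairing is nonzero. If the determinant vanished on an open
subset of `T^*S^7`, then by `thimmPairing_retraction` it would vanish on an open subset of
`R^8 × R^8`, hence everywhere by the identity theorem. -/
theorem functionallyIndependent_thimm (𝔞 : Fin 7 → LieSubalgebra ℝ so8) (v : Fin 7 → R8)
    (y₀ : R8 × R8) (h : (thimmPairing 𝔞 v y₀).det ≠ 0) :
    FunctionallyIndependent fun i => thimmFunction (𝔞 i) := by
  have hcont : Continuous fun y => (thimmPairing 𝔞 v y).det :=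
    (contDiff_det_thimmPairing (n := 0) 𝔞 v).continuous
  refine ⟨{x | (thimmPairing 𝔞 v x.1).det ≠ 0},
    isOpen_ne_fun (hcont.comp continuous_subtype_val) continuous_const, ?_,
    fun x hx => linearIndependent_differential_thimm 𝔞 v x hx⟩
  rw [dense_iff_inter_open]
  rintro _ ⟨N, hN, rfl⟩ ⟨x, hxN⟩
  by_contra hne
  have hzero : ∀ z (hz : z ∈ cotangentSphere), z ∈ N → (thimmPairing 𝔞 v z).det = 0 := by
    intro z hz hzN
    by_contra hzd
    exact hne ⟨⟨z, hz⟩, hzN, hzd⟩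
  have hx0 : x.1.1 ≠ 0 := fun h0 => by
    have := x.2.1
    rw [h0, norm_zero] at this
    exact zero_ne_one this
  -- A determinant that vanishes near `x` on `T^*S^7` vanishes near `x` in `R^8 × R^8`.
  have hev : (fun y => (thimmPairing 𝔞 v y).det) =ᶠ[nhds x.1] 0 := by
    have hN' : N ∈ nhds (retraction x.1) := by
      rw [retraction_of_mem x.2]
      exact hN.mem_nhds hxN
    have h1 : ∀ᶠ y in nhds x.1, retraction y ∈ N := continuousAt_retraction hx0 hN'
    have h2 : ∀ᶠ y : R8 × R8 in nhds x.1, y.1 ≠ 0 :=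
      continuous_fst.continuousAt.eventually_ne hx0
    filter_upwards [h1, h2] with y hy1 hy2
    have := hzero _ (retraction_mem hy2) hy1
    rw [thimmPairing_retraction, Matrix.det_smul] at this
    exact (mul_eq_zero.1 this).resolve_left (by simp [hy2])
  have han : AnalyticOnNhd ℝ (fun y => (thimmPairing 𝔞 v y).det) Set.univ :=
    contDiff_omega_iff_analyticOnNhd.1 (contDiff_det_thimmPairing 𝔞 v)
  exact h (han.eqOn_zero_of_preconnected_of_eventuallyEq_zero isPreconnected_univ
    (Set.mem_univ x.1) hev (Set.mem_univ y₀))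

/-! ### Orthogonal projections to spans -/

/-- The linear span of a family `E` that contains all brackets of its members, as a Lie
subalgebra. -/
def spanSubalgebra {ι : Type*} (E : ι → so8)
    (hE : ∀ s t, ⁅E s, E t⁆ ∈ Submodule.span ℝ (Set.range E)) : LieSubalgebra ℝ so8 where
  __ := Submodule.span ℝ (Set.range E)
  lie_mem' := by
    intro X Y hX hY
    refine Submodule.span_induction₂ (p := fun X Y _ _ => ⁅X, Y⁆ ∈ Submodule.span ℝ (Set.range E))
      ?_ ?_ ?_ ?_ ?_ ?_ ?_ hX hY
    · rintro _ _ ⟨s, rfl⟩ ⟨t, rfl⟩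
      exact hE s t
    · intro Y _
      rw [zero_lie]; exact zero_mem _
    · intro X _
      rw [lie_zero]; exact zero_mem _
    · intro X Y Z _ _ _ h1 h2
      rw [add_lie]; exact add_mem h1 h2
    · intro X Y Z _ _ _ h1 h2
      rw [lie_add]; exact add_mem h1 h2
    · intro r X Y _ _ h
      rw [smul_lie]; exact Submodule.smul_mem _ _ h
    · intro r X Y _ _ h
      rw [lie_smul]; exact Submodule.smul_mem _ _ h

theorem mem_spanSubalgebra {ι : Type*} {E : ι → so8} (hE) (s : ι) : E s ∈ spanSubalgebra E hE :=
  Submodule.subset_span (Set.mem_range_self s)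

theorem spanSubalgebra_le {ι : Type*} {E : ι → so8} (hE) {𝔟 : LieSubalgebra ℝ so8}
    (h : ∀ s, E s ∈ 𝔟) : spanSubalgebra E hE ≤ 𝔟 := by
  have : Submodule.span ℝ (Set.range E) ≤ 𝔟.toSubmodule :=
    Submodule.span_le.2 (by rintro _ ⟨s, rfl⟩; exact h s)
  exact this

/-- The orthogonal projection to the span of a finite family `E`, if the weights `r` make `E` a
tight frame of its span: `∑ r_s B(E_s, Y) E_s = Y`. The members need not be independent, which
allows families with zeros and with both `X` and `-X`. -/
theorem formB_orthProj_spanSubalgebra {ι : Type*} [Fintype ι] {E : ι → so8} (hE) {r : ι → ℝ}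
    (hr : ∀ t, ∑ s, (r s * formB (E s) (E t)) • E s = E t) (X Y : so8) :
    formB (orthProj (spanSubalgebra E hE) X).1 Y = ∑ s, r s * formB (E s) X * formB (E s) Y := by
  have hZ : (orthProj (spanSubalgebra E hE) X).1 = ∑ s, (r s * formB (E s) X) • E s := by
    refine orthProj_eq (sum_mem fun s _ => ?_) fun Y hY => ?_
    · exact Submodule.smul_mem _ _ (Submodule.subset_span (Set.mem_range_self s))
    · have hY' : Y ∈ Submodule.span ℝ (Set.range E) := hY
      refine Submodule.span_induction (p := fun Y _ => formB (∑ s, (r s * formB (E s) X) • E s) Y =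
        formB X Y) ?_ ?_ ?_ ?_ hY'
      · rintro _ ⟨t, rfl⟩
        nth_rewrite 2 [← hr t]
        simp only [map_sum, map_smul, LinearMap.sum_apply, LinearMap.smul_apply, smul_eq_mul]
        refine Finset.sum_congr rfl fun s _ => ?_
        rw [formB_comm X]
        ring
      · simp
      · intro Y Z _ _ h1 h2
        rw [map_add, map_add, h1, h2]
      · intro a Y _ h
        rw [map_smul, map_smul, h]
  rw [hZ]
  simp only [map_sum, map_smul, LinearMap.sum_apply, LinearMap.smul_apply, smul_eq_mul]

/-! ### Bivectors of a Clifford octet -/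

/-- The Kronecker symbol. -/
def δ (i j : Fin 8) : ℝ := if i = j then 1 else 0

theorem δ_comm (i j : Fin 8) : δ i j = δ j i := by
  simp only [δ, eq_comm]

/-- Eight matrices with `Γ_iᵀ Γ_j + Γ_jᵀ Γ_i = 2 δ_ij` and `Γ_i Γ_jᵀ + Γ_j Γ_iᵀ = 2 δ_ij`: the
off-diagonal blocks of a Clifford module over `R^8`. In this form the identity matrix and the
matrices `A_i` play the same role. -/
def IsCliffordOctet (Γ : Fin 8 → Matrix (Fin 8) (Fin 8) ℝ) : Prop :=
  (∀ i j, (Γ i)ᵀ * Γ j + (Γ j)ᵀ * Γ i = (2 * δ i j) • 1) ∧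
    ∀ i j, Γ i * (Γ j)ᵀ + Γ j * (Γ i)ᵀ = (2 * δ i j) • 1

/-- The octet `Γ_0 = 1`, `Γ_i = A_i` for `1 ≤ i ≤ 7`. The matrix `A_i` is `A (i - 1)` but
`octet A i`. -/
def octet (A : Fin 7 → Matrix (Fin 8) (Fin 8) ℝ) : Fin 8 → Matrix (Fin 8) (Fin 8) ℝ :=
  Fin.cons 1 A

theorem isCliffordOctet_octet {A : Fin 7 → Matrix (Fin 8) (Fin 8) ℝ} (hA : IsCliffordFamily A) :
    IsCliffordOctet (octet A) := by
  obtain ⟨h1, h2⟩ := hA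
  have h3 : ∀ i j, A i * A j + A j * A i = (-2 * δ i.succ j.succ) • 1 := fun i j => by
    rw [h2]
    by_cases h : i = j
    · rw [if_pos h, h, ← Algebra.algebraMap_eq_smul_one]
      simp only [δ, if_true, mul_one, map_neg, neg_inj]
      exact (map_ofNat _ 2).symm
    · simp [h, δ]
  constructor
  · intro i j
    refine Fin.cases ?_ (fun i => ?_) i <;> refine Fin.cases ?_ (fun j => ?_) j
    · simp [octet, δ, two_smul]
    · simp [octet, δ, h1, (Fin.succ_ne_zero _).symm]
    · simp [octet, δ, h1]
    · simp only [octet, Fin.cons_succ, h1, neg_mul]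
      rw [← neg_add, h3, ← neg_smul]
      simp
  · intro i j
    refine Fin.cases ?_ (fun i => ?_) i <;> refine Fin.cases ?_ (fun j => ?_) j
    · simp [octet, δ, two_smul]
    · simp [octet, δ, h1, (Fin.succ_ne_zero _).symm]
    · simp [octet, δ, h1]
    · simp only [octet, Fin.cons_succ, h1, mul_neg]
      rw [← neg_add, h3, ← neg_smul]
      simp

section Octet

variable {Γ : Fin 8 → Matrix (Fin 8) (Fin 8) ℝ}

variable (Γ) in
/-- The skew-symmetric matrices `½ (Γ_iᵀ Γ_j - Γ_jᵀ Γ_i)`, which for `i ≠ j` are `Γ_iᵀ Γ_j`. They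
represent the bivectors `e_i ∧ e_j` in the half-spin representation of `so(8)`. -/
def biv (i j : Fin 8) : so8 :=
  ⟨(1 / 2 : ℝ) • ((Γ i)ᵀ * Γ j - (Γ j)ᵀ * Γ i), by
    rw [LieAlgebra.Orthogonal.mem_so, Matrix.transpose_smul, Matrix.transpose_sub,
      Matrix.transpose_mul, Matrix.transpose_mul, Matrix.transpose_transpose,
      Matrix.transpose_transpose, ← smul_neg, neg_sub]⟩

theorem biv_swap (i j : Fin 8) : biv Γ j i = -biv Γ i j := by
  ext1
  simp only [biv, NegMemClass.coe_neg]
  rw [← smul_neg, neg_sub]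

theorem biv_self (i : Fin 8) : biv Γ i i = 0 := by
  ext1
  simp [biv]

theorem coe_biv (hΓ : IsCliffordOctet Γ) (i j : Fin 8) :
    (biv Γ i j).1 = (Γ i)ᵀ * Γ j - δ i j • (1 : Matrix (Fin 8) (Fin 8) ℝ) := by
  have h := hΓ.1 i j
  rw [← eq_sub_iff_add_eq'] at h
  simp only [biv]
  rw [h]
  module

/-- The bracket relations of `so(8)`, up to the factor `2` by which `biv Γ i j` differs from the
standard generator. -/
theorem lie_biv (hΓ : IsCliffordOctet Γ) (i j k l : Fin 8) :
    ⁅biv Γ i j, biv Γ k l⁆ = (2 * δ j k) • biv Γ i l - (2 * δ i k) • biv Γ j l -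
      (2 * δ i l) • biv Γ k j + (2 * δ j l) • biv Γ k i := by
  -- Interchange of the two inner factors; it brings both orders of the product to a common term.
  have hm : ∀ i j k l, ((Γ i)ᵀ * Γ j) * ((Γ k)ᵀ * Γ l) =
      (2 * δ j k) • ((Γ i)ᵀ * Γ l) - ((Γ i)ᵀ * Γ k) * ((Γ j)ᵀ * Γ l) := fun i j k l => by
    have h := hΓ.2 j k
    rw [← eq_sub_iff_add_eq] at h
    rw [mul_assoc, ← mul_assoc (Γ j), h]
    simp only [sub_mul, mul_sub, Matrix.smul_mul, Matrix.mul_smul, one_mul, mul_assoc]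
  have hs : ∀ i j, (Γ i)ᵀ * Γ j = (2 * δ i j) • 1 - (Γ j)ᵀ * Γ i := fun i j => by
    rw [← hΓ.1 i j]; abel
  have h1 : ((Γ i)ᵀ * Γ j) * ((Γ k)ᵀ * Γ l) = (2 * δ j k) • ((Γ i)ᵀ * Γ l) -
      (2 * δ i k) • ((Γ j)ᵀ * Γ l) + ((Γ k)ᵀ * Γ i) * ((Γ j)ᵀ * Γ l) := by
    rw [hm, hs i k, sub_mul, Matrix.smul_mul, one_mul]; abel
  have h2 : ((Γ k)ᵀ * Γ l) * ((Γ i)ᵀ * Γ j) = (2 * δ i l) • ((Γ k)ᵀ * Γ j) -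
      (2 * δ j l) • ((Γ k)ᵀ * Γ i) + ((Γ k)ᵀ * Γ i) * ((Γ j)ᵀ * Γ l) := by
    rw [hm, hs l j, mul_sub, Matrix.mul_smul, mul_one, δ_comm l i, δ_comm l j]; abel
  ext1
  simp only [LieSubalgebra.coe_bracket, AddMemClass.coe_add, AddSubgroupClass.coe_sub,
    SetLike.val_smul, coe_biv hΓ, Ring.lie_def, mul_sub, sub_mul, h1, h2, Matrix.smul_mul,
    Matrix.mul_smul, one_mul, mul_one]
  rw [δ_comm k j, δ_comm k i]
  module

theorem trace_coe (X : so8) : X.1.trace = 0 := by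
  have := congrArg Matrix.trace (transpose_coe X)
  rw [Matrix.trace_transpose, Matrix.trace_neg] at this
  linarith

/-- Inner products of bivectors with a common index `m`: their product is `Γ_iᵀ Γ_j`, which has
trace `8 δ_ij`. -/
theorem formB_biv_common (hΓ : IsCliffordOctet Γ) {m i j : Fin 8} (hi : i ≠ m) (hj : j ≠ m) :
    formB (biv Γ i m) (biv Γ m j) = -8 * δ i j := by
  have h : Γ m * (Γ m)ᵀ = 1 := by
    have := hΓ.2 m m
    rw [← two_smul ℝ, show (2 * δ m m) = 2 by simp [δ]] at this
    exact smul_right_injective _ (two_ne_zero' ℝ) this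
  have e : (Γ i)ᵀ * Γ j = (biv Γ i j).1 + δ i j • 1 := by rw [coe_biv hΓ]; abel
  simp only [formB, LinearMap.mk₂_apply, transpose_coe]
  rw [coe_biv hΓ, coe_biv hΓ, show δ i m = 0 by simp [δ, hi], show δ m j = 0 by simp [δ, hj.symm],
    zero_smul, sub_zero, sub_zero, neg_mul, mul_assoc, ← mul_assoc (Γ m), h, one_mul, e,
    Matrix.trace_neg, Matrix.trace_add, trace_coe, Matrix.trace_smul, Matrix.trace_one]
  simp
  ring

/-- The bivectors are orthogonal, with `B`-norm squared `8`. -/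
theorem formB_biv (hΓ : IsCliffordOctet Γ) (i j k l : Fin 8) :
    formB (biv Γ i j) (biv Γ k l) = 8 * (δ i k * δ j l - δ i l * δ j k) := by
  -- With an index `m` different from all others, `2 biv Γ i j = [biv Γ i m, biv Γ m j]`, and
  -- invariance of `B` reduces the claim to bivectors with the common index `m`.
  obtain ⟨m, hmi, hmj, hmk, hml⟩ : ∃ m : Fin 8, i ≠ m ∧ j ≠ m ∧ k ≠ m ∧ l ≠ m := by
    obtain ⟨m, hm⟩ := Finset.exists_mem_notMem_of_card_lt_card (s := {i, j, k, l})
      (t := (Finset.univ : Finset (Fin 8))) (lt_of_le_of_lt Finset.card_le_four (by simp))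
    simp only [Finset.mem_insert, Finset.mem_singleton, not_or] at hm
    exact ⟨m, Ne.symm hm.2.1, Ne.symm hm.2.2.1, Ne.symm hm.2.2.2.1, Ne.symm hm.2.2.2.2⟩
  by_cases hij : i = j
  · subst hij
    rw [biv_self, map_zero, LinearMap.zero_apply]
    ring
  have h1 : ⁅biv Γ i m, biv Γ m j⁆ = (2 : ℝ) • biv Γ i j := by
    rw [lie_biv hΓ]
    simp [δ, hij, hmi, hmj.symm, biv_self]
  have h2 : ⁅biv Γ m j, biv Γ k l⁆ = (2 * δ j k) • biv Γ m l - (2 * δ j l) • biv Γ m k := by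
    rw [lie_biv hΓ]
    simp only [δ, if_neg hmk.symm, if_neg hml.symm, biv_swap m k]
    module
  have h3 : (2 : ℝ) * formB (biv Γ i j) (biv Γ k l) =
      2 * (8 * (δ i k * δ j l - δ i l * δ j k)) := by
    rw [← smul_eq_mul, ← LinearMap.smul_apply, ← map_smul, ← h1, formB_lie, h2, map_sub, map_smul,
      map_smul, formB_biv_common hΓ hmi hml, formB_biv_common hΓ hmi hmk, smul_eq_mul, smul_eq_mul]
    ring
  linarith

end Octet

/-! ### Subalgebras from blocks of indices -/

section Blocks

variable {Γ : Fin 8 → Matrix (Fin 8) (Fin 8) ℝ}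

/-- A colouring `c` of the indices divides those of nonzero colour into blocks; indices of colour
`0` lie in no block. -/
def SameBlock (c : Fin 8 → ℕ) (i j : Fin 8) : Prop := c i = c j ∧ c i ≠ 0

instance (c : Fin 8 → ℕ) (i j : Fin 8) : Decidable (SameBlock c i j) :=
  inferInstanceAs (Decidable (_ ∧ _))

variable (Γ) in
/-- The bivectors with both indices in one block, and `0` for the other pairs of indices. -/
def blockGen (c : Fin 8 → ℕ) (s : Fin 8 × Fin 8) : so8 :=
  if SameBlock c s.1 s.2 then biv Γ s.1 s.2 else 0

theorem blockGen_of_not {c : Fin 8 → ℕ} {s : Fin 8 × Fin 8} (h : ¬SameBlock c s.1 s.2) :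
    blockGen Γ c s = 0 := if_neg h

theorem blockGen_of {c : Fin 8 → ℕ} {i j : Fin 8} (h : SameBlock c i j) :
    blockGen Γ c (i, j) = biv Γ i j := if_pos h

theorem δ_smul_mem {M : Submodule ℝ so8} {i j : Fin 8} {a : ℝ} {X : so8} (h : i = j → X ∈ M) :
    (a * δ i j) • X ∈ M := by
  by_cases hij : i = j
  · exact M.smul_mem _ (h hij)
  · simp [δ, hij]

theorem lie_blockGen_mem (hΓ : IsCliffordOctet Γ) (c : Fin 8 → ℕ) (s t : Fin 8 × Fin 8) :
    ⁅blockGen Γ c s, blockGen Γ c t⁆ ∈ Submodule.span ℝ (Set.range (blockGen Γ c)) := by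
  have hmem : ∀ {i j}, SameBlock c i j →
      biv Γ i j ∈ Submodule.span ℝ (Set.range (blockGen Γ c)) := fun {i j} h => by
    rw [← blockGen_of h]
    exact Submodule.subset_span (Set.mem_range_self _)
  by_cases hs : SameBlock c s.1 s.2
  swap
  · rw [blockGen_of_not hs, zero_lie]; exact zero_mem _
  by_cases ht : SameBlock c t.1 t.2
  swap
  · rw [blockGen_of_not ht, lie_zero]; exact zero_mem _
  rw [blockGen, if_pos hs, blockGen, if_pos ht, lie_biv hΓ]
  obtain ⟨h1, h2⟩ := hs
  obtain ⟨h3, h4⟩ := ht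
  refine add_mem (sub_mem (sub_mem ?_ ?_) ?_) ?_ <;> refine δ_smul_mem fun h => hmem ?_ <;>
    constructor <;> simp_all

/-- The subalgebra spanned by the bivectors within the blocks of the colouring `c`: a direct sum of
one copy of `so(m)` for each block of `m` indices. -/
def blockAlgebra (hΓ : IsCliffordOctet Γ) (c : Fin 8 → ℕ) : LieSubalgebra ℝ so8 :=
  spanSubalgebra (blockGen Γ c) (lie_blockGen_mem hΓ c)

theorem biv_mem_blockAlgebra (hΓ : IsCliffordOctet Γ) {c : Fin 8 → ℕ} {i j : Fin 8}
    (h : SameBlock c i j) : biv Γ i j ∈ blockAlgebra hΓ c := by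
  rw [← blockGen_of h]
  exact mem_spanSubalgebra _ _

/-- The bivectors of a block algebra form a tight frame with weight `1 / 16`: each of norm squared
`8` occurs twice, with both signs. -/
theorem sum_smul_blockGen (hΓ : IsCliffordOctet Γ) (c : Fin 8 → ℕ) {k l : Fin 8}
    (h : SameBlock c k l) :
    ∑ s, (1 / 16 * formB (blockGen Γ c s) (biv Γ k l)) • blockGen Γ c s = biv Γ k l := by
  have h' : SameBlock c l k := ⟨h.1.symm, h.1 ▸ h.2⟩
  have e : ∀ s : Fin 8 × Fin 8,
      (1 / 16 * formB (blockGen Γ c s) (biv Γ k l)) • blockGen Γ c s =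
        (1 / 2 * (δ s.1 k * δ s.2 l)) • biv Γ k l - (1 / 2 * (δ s.1 l * δ s.2 k)) • biv Γ l k := by
    rintro ⟨i, j⟩
    by_cases hij : SameBlock c i j
    · rw [blockGen_of hij, formB_biv hΓ]
      by_cases h1 : i = k ∧ j = l
      · obtain ⟨rfl, rfl⟩ := h1
        by_cases h2 : i = j
        · subst h2; simp [biv_self]
        · simp [δ, h2]; norm_num
      · by_cases h2 : i = l ∧ j = k
        · obtain ⟨rfl, rfl⟩ := h2
          have : i ≠ j := fun hh => h1 ⟨hh, hh.symm⟩
          simp [δ, this]; norm_num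
        · have e1 : δ i k * δ j l = 0 := by
            simp only [δ]; split_ifs <;> simp_all
          have e2 : δ i l * δ j k = 0 := by
            simp only [δ]; split_ifs <;> simp_all
          simp [e1, e2]
    · rw [blockGen_of_not hij]
      have e1 : δ i k * δ j l = 0 := by
        simp only [δ]; split_ifs <;> simp_all
      have e2 : δ i l * δ j k = 0 := by
        simp only [δ]; split_ifs <;> simp_all
      simp [e1, e2]
  -- No assumption on `a` and `b` is needed: exactly one pair `s` contributes.
  have e3 : ∀ a b : Fin 8, ∑ s : Fin 8 × Fin 8, 1 / 2 * (δ s.1 a * δ s.2 b) = (1 / 2 : ℝ) := by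
    intro a b
    simp [Fintype.sum_prod_type, δ]
  simp only [e, Finset.sum_sub_distrib, ← Finset.sum_smul, e3]
  rw [biv_swap]
  module

theorem formB_orthProj_blockAlgebra (hΓ : IsCliffordOctet Γ) (c : Fin 8 → ℕ) (X Y : so8) :
    formB (orthProj (blockAlgebra hΓ c) X).1 Y =
      ∑ i, ∑ j, if SameBlock c i j then
        1 / 16 * formB (biv Γ i j) X * formB (biv Γ i j) Y else 0 := by
  rw [blockAlgebra, formB_orthProj_spanSubalgebra (r := fun _ => 1 / 16), Fintype.sum_prod_type]
  · refine Finset.sum_congr rfl fun i _ => Finset.sum_congr rfl fun j _ => ?_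
    by_cases h : SameBlock c i j
    · rw [blockGen_of h, if_pos h]
    · rw [blockGen_of_not h, if_neg h]; simp
  · rintro ⟨k, l⟩
    by_cases h : SameBlock c k l
    · rw [blockGen_of h]; exact sum_smul_blockGen hΓ c h
    · rw [blockGen_of_not h]; simp

variable (Γ) in
/-- A basis of a copy of `u(2)` in the `so(4)` on the indices `1, 2, 3, 4`: the centralizer there of
`biv Γ 1 2 + biv Γ 3 4`. -/
def unitaryGen : Fin 4 → so8 :=
  ![biv Γ 1 2, biv Γ 3 4, biv Γ 1 3 + biv Γ 2 4, biv Γ 1 4 - biv Γ 2 3]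

theorem lie_unitaryGen_mem (hΓ : IsCliffordOctet Γ) (m n : Fin 4) :
    ⁅unitaryGen Γ m, unitaryGen Γ n⁆ ∈ Submodule.span ℝ (Set.range (unitaryGen Γ)) := by
  have hmem : ∀ m, unitaryGen Γ m ∈ Submodule.span ℝ (Set.range (unitaryGen Γ)) := fun m =>
    Submodule.subset_span (Set.mem_range_self m)
  have hlt : ∀ m n, m < n →
      ⁅unitaryGen Γ m, unitaryGen Γ n⁆ ∈ Submodule.span ℝ (Set.range (unitaryGen Γ)) := by
    have h01 : ⁅unitaryGen Γ 0, unitaryGen Γ 1⁆ = 0 := by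
      simp [unitaryGen, lie_biv hΓ, δ]
    have h02 : ⁅unitaryGen Γ 0, unitaryGen Γ 2⁆ = (2 : ℝ) • unitaryGen Γ 3 := by
      simp [unitaryGen, lie_biv hΓ, δ]; module
    have h03 : ⁅unitaryGen Γ 0, unitaryGen Γ 3⁆ = (-2 : ℝ) • unitaryGen Γ 2 := by
      simp [unitaryGen, lie_biv hΓ, δ]; module
    have h12 : ⁅unitaryGen Γ 1, unitaryGen Γ 2⁆ = (-2 : ℝ) • unitaryGen Γ 3 := by
      simp [unitaryGen, lie_biv hΓ, δ]; module
    have h13 : ⁅unitaryGen Γ 1, unitaryGen Γ 3⁆ = (2 : ℝ) • unitaryGen Γ 2 := by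
      simp [unitaryGen, lie_biv hΓ, δ]
    have h23 : ⁅unitaryGen Γ 2, unitaryGen Γ 3⁆ =
        (4 : ℝ) • unitaryGen Γ 0 + (-4 : ℝ) • unitaryGen Γ 1 := by
      simp [unitaryGen, lie_biv hΓ, δ, biv_swap 1 2, biv_swap 3 4]; module
    intro m n hmn
    fin_cases m <;> fin_cases n <;> simp at hmn
    · change ⁅unitaryGen Γ 0, unitaryGen Γ 1⁆ ∈ _
      rw [h01]; exact zero_mem _
    · change ⁅unitaryGen Γ 0, unitaryGen Γ 2⁆ ∈ _
      rw [h02]; exact Submodule.smul_mem _ _ (hmem _)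
    · change ⁅unitaryGen Γ 0, unitaryGen Γ 3⁆ ∈ _
      rw [h03]; exact Submodule.smul_mem _ _ (hmem _)
    · change ⁅unitaryGen Γ 1, unitaryGen Γ 2⁆ ∈ _
      rw [h12]; exact Submodule.smul_mem _ _ (hmem _)
    · change ⁅unitaryGen Γ 1, unitaryGen Γ 3⁆ ∈ _
      rw [h13]; exact Submodule.smul_mem _ _ (hmem _)
    · change ⁅unitaryGen Γ 2, unitaryGen Γ 3⁆ ∈ _
      rw [h23]
      exact add_mem (Submodule.smul_mem _ _ (hmem _)) (Submodule.smul_mem _ _ (hmem _))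
  rcases lt_trichotomy m n with h | rfl | h
  · exact hlt m n h
  · rw [lie_self]; exact zero_mem _
  · rw [← lie_skew]; exact neg_mem (hlt n m h)

end Blocks

/-! ### Sums of a unitary algebra and a block algebra -/

section Stages

variable {Γ : Fin 8 → Matrix (Fin 8) (Fin 8) ℝ}

/-- The colouring `c` with the indices `1, 2, 3, 4` removed from its blocks. -/
def mask (c : Fin 8 → ℕ) (i : Fin 8) : ℕ := if 1 ≤ i ∧ i ≤ 4 then 0 else c i

theorem lie_biv_of_disjoint (hΓ : IsCliffordOctet Γ) {i j k l : Fin 8} (hik : i ≠ k) (hil : i ≠ l)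
    (hjk : j ≠ k) (hjl : j ≠ l) : ⁅biv Γ i j, biv Γ k l⁆ = 0 := by
  rw [lie_biv hΓ]
  simp [δ, hik, hil, hjk, hjl]

theorem SameBlock.ne_of_mask {c : Fin 8 → ℕ} {i j : Fin 8} (h : SameBlock (mask c) i j)
    {k : Fin 8} (hk : 1 ≤ k ∧ k ≤ 4) : i ≠ k ∧ j ≠ k := by
  have h0 : mask c k = 0 := if_pos hk
  exact ⟨fun e => h.2 (e ▸ h0), fun e => h.2 (h.1.trans (e ▸ h0))⟩

theorem lie_biv_unitaryGen (hΓ : IsCliffordOctet Γ) {c : Fin 8 → ℕ} {i j : Fin 8}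
    (h : SameBlock (mask c) i j) (n : Fin 4) : ⁅biv Γ i j, unitaryGen Γ n⁆ = 0 := by
  have h1 := h.ne_of_mask (k := 1) (by decide)
  have h2 := h.ne_of_mask (k := 2) (by decide)
  have h3 := h.ne_of_mask (k := 3) (by decide)
  have h4 := h.ne_of_mask (k := 4) (by decide)
  fin_cases n <;> simp [unitaryGen, lie_biv_of_disjoint hΓ, h1, h2, h3, h4]

theorem formB_biv_unitaryGen (hΓ : IsCliffordOctet Γ) {c : Fin 8 → ℕ} {i j : Fin 8}
    (h : SameBlock (mask c) i j) (n : Fin 4) : formB (biv Γ i j) (unitaryGen Γ n) = 0 := by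
  have h1 := h.ne_of_mask (k := 1) (by decide)
  have h2 := h.ne_of_mask (k := 2) (by decide)
  have h3 := h.ne_of_mask (k := 3) (by decide)
  have h4 := h.ne_of_mask (k := 4) (by decide)
  fin_cases n <;> simp [unitaryGen, formB_biv hΓ, δ, h1, h2, h3, h4]

variable (Γ) in
/-- The generators of `unitaryBlockAlgebra`. -/
def unitaryBlockGen (c : Fin 8 → ℕ) : Fin 8 × Fin 8 ⊕ Fin 4 → so8 :=
  Sum.elim (blockGen Γ (mask c)) (unitaryGen Γ)

theorem lie_unitaryBlockGen_mem (hΓ : IsCliffordOctet Γ) (c : Fin 8 → ℕ)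
    (s t : Fin 8 × Fin 8 ⊕ Fin 4) : ⁅unitaryBlockGen Γ c s, unitaryBlockGen Γ c t⁆ ∈
      Submodule.span ℝ (Set.range (unitaryBlockGen Γ c)) := by
  have h1 : Submodule.span ℝ (Set.range (blockGen Γ (mask c))) ≤
      Submodule.span ℝ (Set.range (unitaryBlockGen Γ c)) :=
    Submodule.span_mono (by rintro _ ⟨s, rfl⟩; exact ⟨Sum.inl s, rfl⟩)
  have h2 : Submodule.span ℝ (Set.range (unitaryGen Γ)) ≤
      Submodule.span ℝ (Set.range (unitaryBlockGen Γ c)) :=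
    Submodule.span_mono (by rintro _ ⟨s, rfl⟩; exact ⟨Sum.inr s, rfl⟩)
  have h3 : ∀ s n, ⁅blockGen Γ (mask c) s, unitaryGen Γ n⁆ = 0 := fun s n => by
    by_cases h : SameBlock (mask c) s.1 s.2
    · rw [blockGen, if_pos h, lie_biv_unitaryGen hΓ h]
    · rw [blockGen_of_not h, zero_lie]
  rcases s with s | m <;> rcases t with t | n
  · exact h1 (lie_blockGen_mem hΓ _ s t)
  · change ⁅blockGen Γ (mask c) s, unitaryGen Γ n⁆ ∈ _
    rw [h3]; exact zero_mem _
  · change ⁅unitaryGen Γ m, blockGen Γ (mask c) t⁆ ∈ _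
    rw [← lie_skew, h3, neg_zero]; exact zero_mem _
  · exact h2 (lie_unitaryGen_mem hΓ m n)

/-- The direct sum of `u(2)` on the indices `1, 2, 3, 4` and of the block algebra of the colouring
`c` on the remaining indices. -/
def unitaryBlockAlgebra (hΓ : IsCliffordOctet Γ) (c : Fin 8 → ℕ) : LieSubalgebra ℝ so8 :=
  spanSubalgebra (unitaryBlockGen Γ c) (lie_unitaryBlockGen_mem hΓ c)

/-- The weights of the generators of `u(2)` are the inverses of their norms squared
`8, 8, 16, 16`. -/
theorem formB_orthProj_unitaryBlockAlgebra (hΓ : IsCliffordOctet Γ) (c : Fin 8 → ℕ) (X Y : so8) :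
    formB (orthProj (unitaryBlockAlgebra hΓ c) X).1 Y =
      (∑ i, ∑ j, if SameBlock (mask c) i j then
        1 / 16 * formB (biv Γ i j) X * formB (biv Γ i j) Y else 0) +
      ∑ n, ![1 / 8, 1 / 8, 1 / 16, 1 / 16] n * formB (unitaryGen Γ n) X *
        formB (unitaryGen Γ n) Y := by
  rw [← formB_orthProj_blockAlgebra hΓ, unitaryBlockAlgebra, formB_orthProj_spanSubalgebra
    (r := Sum.elim (fun _ => 1 / 16) ![1 / 8, 1 / 8, 1 / 16, 1 / 16]), Fintype.sum_sum_type,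
    blockAlgebra, formB_orthProj_spanSubalgebra (r := fun _ => 1 / 16)]
  · rfl
  · rintro ⟨k, l⟩
    by_cases h : SameBlock (mask c) k l
    · rw [blockGen_of h]; exact sum_smul_blockGen hΓ _ h
    · rw [blockGen_of_not h]; simp
  · rintro (⟨k, l⟩ | n)
    · by_cases h : SameBlock (mask c) k l
      · have := sum_smul_blockGen hΓ _ h
        simp only [Fintype.sum_sum_type, unitaryBlockGen, Sum.elim_inl, Sum.elim_inr,
          blockGen_of h, this]
        simp [formB_comm _ (biv Γ k l), formB_biv_unitaryGen hΓ h]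
      · simp [unitaryBlockGen, blockGen_of_not (s := (k, l)) h]
    · have h0 : ∀ s, formB (blockGen Γ (mask c) s) (unitaryGen Γ n) = 0 := fun s => by
        by_cases h : SameBlock (mask c) s.1 s.2
        · rw [blockGen, if_pos h, formB_biv_unitaryGen hΓ h]
        · rw [blockGen_of_not h, map_zero, LinearMap.zero_apply]
      simp only [Fintype.sum_sum_type, unitaryBlockGen, Sum.elim_inl, Sum.elim_inr, h0, mul_zero,
        zero_smul, Finset.sum_const_zero, zero_add, Fin.sum_univ_four]
      fin_cases n <;> simp [unitaryGen, formB_biv hΓ, δ] <;> norm_num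

/-- A combinatorial description of the subalgebras that make up the chains. -/
inductive Stage where
  | block (c : Fin 8 → ℕ)
  | unitary (c : Fin 8 → ℕ)
  | top

/-- The subalgebra of `so(8)` that a stage describes: a block algebra, the sum of `u(2)` and a block
algebra, or `so(8)` itself. -/
def Stage.algebra (hΓ : IsCliffordOctet Γ) : Stage → LieSubalgebra ℝ so8
  | block c => blockAlgebra hΓ c
  | unitary c => unitaryBlockAlgebra hΓ c
  | top => ⊤

/-- A decidable condition on stages that is sufficient for inclusion of their subalgebras. For a
block stage below a unitary one, the pairs listed are the bivectors that lie in `u(2)`. Two unitary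
stages never occur in one chain, and are not compared. -/
def Stage.Refines : Stage → Stage → Prop
  | _, top => True
  | block c, block c' => ∀ i j, SameBlock c i j → SameBlock c' i j
  | block c, unitary c' => ∀ i j, SameBlock c i j →
      i = j ∨ SameBlock (mask c') i j ∨
        (i, j) ∈ [((1 : Fin 8), (2 : Fin 8)), (2, 1), (3, 4), (4, 3)]
  | unitary c, block c' => ∀ i j, SameBlock (mask c) i j ∨ ((1 ≤ i ∧ i ≤ 4) ∧ 1 ≤ j ∧ j ≤ 4) →
      SameBlock c' i j
  | _, _ => False

instance (s t : Stage) : Decidable (s.Refines t) := by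
  cases s <;> cases t <;> unfold Stage.Refines <;> infer_instance

theorem Stage.Refines.le (hΓ : IsCliffordOctet Γ) {s t : Stage} (h : s.Refines t) :
    s.algebra hΓ ≤ t.algebra hΓ := by
  have hB : ∀ {c : Fin 8 → ℕ} {𝔟 : LieSubalgebra ℝ so8},
      (∀ i j, SameBlock c i j → biv Γ i j ∈ 𝔟) → ∀ s, blockGen Γ c s ∈ 𝔟 := fun hc s => by
    unfold blockGen
    split_ifs with h
    · exact hc _ _ h
    · exact zero_mem _
  match s, t, h with
  | _, top, _ => exact le_top
  | block c, block c', h =>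
    exact spanSubalgebra_le (lie_blockGen_mem hΓ c)
      (hB fun i j hij => biv_mem_blockAlgebra hΓ (h i j hij))
  | block c, unitary c', h =>
    refine spanSubalgebra_le (lie_blockGen_mem hΓ c) (hB fun i j hij => ?_)
    rcases h i j hij with rfl | h | h
    · rw [biv_self]
      exact zero_mem _
    · rw [← blockGen_of h]
      exact mem_spanSubalgebra (lie_unitaryBlockGen_mem hΓ c') (Sum.inl (i, j))
    · have h0 := mem_spanSubalgebra (lie_unitaryBlockGen_mem hΓ c') (Sum.inr 0)
      have h1 := mem_spanSubalgebra (lie_unitaryBlockGen_mem hΓ c') (Sum.inr 1)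
      simp only [List.mem_cons, Prod.mk.injEq, List.not_mem_nil, or_false] at h
      rcases h with ⟨rfl, rfl⟩ | ⟨rfl, rfl⟩ | ⟨rfl, rfl⟩ | ⟨rfl, rfl⟩
      · exact h0
      · rw [biv_swap]; exact neg_mem h0
      · exact h1
      · rw [biv_swap]; exact neg_mem h1
  | unitary c, block c', h =>
    refine spanSubalgebra_le (lie_unitaryBlockGen_mem hΓ c) ?_
    rintro (s | n)
    · exact hB (fun i j hij => biv_mem_blockAlgebra hΓ (h i j (Or.inl hij))) s
    · have h' : ∀ i j : Fin 8, (1 ≤ i ∧ i ≤ 4) ∧ 1 ≤ j ∧ j ≤ 4 → biv Γ i j ∈ blockAlgebra hΓ c' :=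
        fun i j hij => biv_mem_blockAlgebra hΓ (h i j (Or.inr hij))
      fin_cases n
      · exact h' 1 2 (by decide)
      · exact h' 3 4 (by decide)
      · exact add_mem (h' 1 3 (by decide)) (h' 2 4 (by decide))
      · exact sub_mem (h' 1 4 (by decide)) (h' 2 3 (by decide))

end Stages

/-! ### Octonion frames -/

section Frame

/-- The signs in the multiplication table of the octonions, with units labelled so that
`e_k e_i = ± e_(k xor i)`. -/
def cayleySign : Matrix (Fin 8) (Fin 8) ℤ :=
  !![1, 1, 1, 1, 1, 1, 1, 1;
     1, -1, -1, 1, -1, 1, -1, 1;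
     1, 1, -1, -1, -1, 1, 1, -1;
     1, -1, 1, -1, 1, 1, -1, -1;
     1, 1, 1, -1, -1, -1, -1, 1;
     1, -1, -1, -1, 1, -1, 1, 1;
     1, 1, -1, 1, 1, -1, -1, -1;
     1, -1, 1, 1, -1, -1, 1, -1]

/-- An orthonormal basis of `R^8` on which the matrices `Γ_k` act as left multiplication by the
octonion units. -/
def IsOctonionFrame (Γ : Fin 8 → Matrix (Fin 8) (Fin 8) ℝ) (b : Fin 8 → R8) : Prop :=
  Orthonormal ℝ b ∧ ∀ k i, act (Γ k) (b i) = (cayleySign k i : ℝ) • b (k ^^^ i)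

/-- The linear action of a matrix on `R^8`, as a linear map. -/
def actHom (M : Matrix (Fin 8) (Fin 8) ℝ) : R8 →ₗ[ℝ] R8 where
  toFun := act M
  map_add' u v := by ext i; simp [act, Matrix.mulVec_add]
  map_smul' c u := by ext i; simp [act, Matrix.mulVec_smul]

theorem actHom_apply (M : Matrix (Fin 8) (Fin 8) ℝ) (q : R8) : actHom M q = act M q := rfl

theorem act_smul (c : ℝ) (M : Matrix (Fin 8) (Fin 8) ℝ) (q : R8) :
    act (c • M) q = c • act M q := by
  ext i; simp [act, Matrix.smul_mulVec]

theorem act_one (q : R8) : act 1 q = q := by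
  ext i; simp [act]

section Involutions

variable {V : Type*} [AddCommGroup V] [Module ℝ V]

/-- The eigenvector has the form `e ± T e`, so that it stays in every eigenspace of a map that
commutes with `T`. -/
theorem exists_sign_eigenvector {T : V →ₗ[ℝ] V} (hT : ∀ v, T (T v) = v) {e : V} (he : e ≠ 0) :
    ∃ t : ℝ, (t = 1 ∨ t = -1) ∧ e + t • T e ≠ 0 ∧ T (e + t • T e) = t • (e + t • T e) := by
  by_cases h : e + T e = 0
  · refine ⟨-1, Or.inr rfl, fun h' => he ?_, ?_⟩
    · have : (2 : ℝ) • e = (e + T e) + (e + (-1 : ℝ) • T e) := by module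
      rw [h, h', add_zero] at this
      exact (smul_eq_zero.1 this).resolve_left two_ne_zero
    · rw [map_add, map_smul, hT]; module
  · refine ⟨1, Or.inl rfl, by simpa using h, ?_⟩
    rw [map_add, map_smul, hT]; module

/-- Commuting involutions have a common eigenvector. -/
theorem exists_common_sign_eigenvector {n : ℕ} (T : Fin n → V →ₗ[ℝ] V)
    (hT : ∀ i v, T i (T i v) = v) (hTT : ∀ i j v, T i (T j v) = T j (T i v)) {e : V}
    (he : e ≠ 0) :
    ∃ (t : Fin n → ℝ) (v : V), (∀ i, t i = 1 ∨ t i = -1) ∧ v ≠ 0 ∧ ∀ i, T i v = t i • v := by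
  induction n with
  | zero => exact ⟨fun _ => 1, e, fun i => i.elim0, he, fun i => i.elim0⟩
  | succ n ih =>
    obtain ⟨t, v, ht, hv, hTv⟩ := ih (fun i => T i.succ) (fun i => hT _) fun i j => hTT _ _
    obtain ⟨t0, ht0, hv0, hTv0⟩ := exists_sign_eigenvector (hT 0) hv
    refine ⟨Fin.cons t0 t, v + t0 • T 0 v, Fin.cases ht0 ht, hv0, Fin.cases hTv0 fun i => ?_⟩
    rw [map_add, map_smul, hTT, hTv, map_smul, Fin.cons_succ]
    module

variable {a : Fin 7 → V →ₗ[ℝ] V}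

/-- If `a_i a_j a_k e = s e` for anticommuting complex structures, then each of the three products
of two of them takes `e` to a multiple of the third one applied to `e`: a line of the Fano plane. -/
theorem clifford_line (hsq : ∀ i v, a i (a i v) = -v)
    (hanti : ∀ i j, i ≠ j → ∀ v, a i (a j v) = -a j (a i v)) {i j k : Fin 7} (hij : i ≠ j)
    (hik : i ≠ k) (hjk : j ≠ k) {e : V} {s : ℝ} (h : a i (a j (a k e)) = s • e) :
    a j (a k e) = -(s • a i e) ∧ a i (a k e) = s • a j e ∧ a i (a j e) = -(s • a k e) := by
  have h1 := congrArg (a i) h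
  have h2 := congrArg (a j) h
  have h3 := congrArg (a k) h
  rw [map_smul] at h1 h2 h3
  rw [hsq] at h1
  rw [hanti j i hij.symm, hsq, map_neg, neg_neg] at h2
  rw [hanti k i hik.symm, hanti k j hjk.symm, hsq, map_neg, map_neg, map_neg, neg_neg] at h3
  refine ⟨?_, h2, ?_⟩
  · rw [← h1, neg_neg]
  · rw [← h3, neg_neg]

end Involutions

/-- The relations of four lines of the Fano plane determine those of the other three and hence, as
the matrices anticommute, the action of all matrices on `e, A_1 e, …, A_7 e`. -/
theorem act_octet_frame {A : Fin 7 → Matrix (Fin 8) (Fin 8) ℝ} {e : R8}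
    (hsq : ∀ i v, act (A i) (act (A i) v) = -v)
    (hanti : ∀ i j, i ≠ j → ∀ v, act (A i) (act (A j) v) = -act (A j) (act (A i) v))
    (h123 : act (A 0) (act (A 1) (act (A 2) e)) = e)
    (h145 : act (A 0) (act (A 3) (act (A 4) e)) = e)
    (h167 : act (A 0) (act (A 5) (act (A 6) e)) = e)
    (h246 : act (A 1) (act (A 3) (act (A 5) e)) = e) (k i : Fin 8) :
    act (octet A k) (act (octet A i) e) = (cayleySign k i : ℝ) • act (octet A (k ^^^ i)) e := by
  simp only [← actHom_apply] at *
  set a : Fin 7 → R8 →ₗ[ℝ] R8 := fun i => actHom (A i) with ha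
  change ∀ i v, a i (a i v) = -v at hsq
  change ∀ i j, i ≠ j → ∀ v, a i (a j v) = -a j (a i v) at hanti
  change a 0 (a 1 (a 2 e)) = e at h123
  change a 0 (a 3 (a 4 e)) = e at h145
  change a 0 (a 5 (a 6 e)) = e at h167
  change a 1 (a 3 (a 5 e)) = e at h246
  have r10 := hanti 1 0 (by decide)
  have r20 := hanti 2 0 (by decide)
  have r21 := hanti 2 1 (by decide)
  have r30 := hanti 3 0 (by decide)
  have r31 := hanti 3 1 (by decide)
  have r32 := hanti 3 2 (by decide)
  have r40 := hanti 4 0 (by decide)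
  have r41 := hanti 4 1 (by decide)
  have r42 := hanti 4 2 (by decide)
  have r43 := hanti 4 3 (by decide)
  have r50 := hanti 5 0 (by decide)
  have r51 := hanti 5 1 (by decide)
  have r52 := hanti 5 2 (by decide)
  have r53 := hanti 5 3 (by decide)
  have r54 := hanti 5 4 (by decide)
  have r60 := hanti 6 0 (by decide)
  have r61 := hanti 6 1 (by decide)
  have r62 := hanti 6 2 (by decide)
  have r63 := hanti 6 3 (by decide)
  have r64 := hanti 6 4 (by decide)
  have r65 := hanti 6 5 (by decide)
  have line := @clifford_line R8 _ _ a hsq hanti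
  obtain ⟨h23, h13, h12⟩ := line (i := 0) (j := 1) (k := 2) (by decide) (by decide) (by decide)
    (s := 1) (by rw [one_smul]; exact h123)
  obtain ⟨h45, h15, h14⟩ := line (i := 0) (j := 3) (k := 4) (by decide) (by decide) (by decide)
    (s := 1) (by rw [one_smul]; exact h145)
  obtain ⟨h67, h17, h16⟩ := line (i := 0) (j := 5) (k := 6) (by decide) (by decide) (by decide)
    (s := 1) (by rw [one_smul]; exact h167)
  obtain ⟨h46, h26, h24⟩ := line (i := 1) (j := 3) (k := 5) (by decide) (by decide) (by decide)
    (s := 1) (by rw [one_smul]; exact h246)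
  simp only [one_smul] at h12 h13 h23 h14 h15 h45 h16 h17 h67 h24 h26 h46
  have e7 : a 6 e = -a 0 (a 5 e) := by rw [h16, neg_neg]
  have e6 : a 5 e = -a 1 (a 3 e) := by rw [h24, neg_neg]
  -- The three remaining lines follow from the first four; on these three the sign is `-1`.
  obtain ⟨h57, h27, h25⟩ := line (i := 1) (j := 4) (k := 6) (by decide) (by decide) (by decide)
    (s := -1) (e := e) (by
      rw [e7, e6]
      simp only [map_neg, neg_neg, hsq, neg_smul, one_smul, r41, r40, r10, r43, h145])
  obtain ⟨h47, h37, h34⟩ := line (i := 2) (j := 3) (k := 6) (by decide) (by decide) (by decide)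
    (s := -1) (e := e) (by
      rw [e7, e6]
      simp only [map_neg, neg_neg, hsq, neg_smul, one_smul, r31, r30, r20, r21, h123])
  obtain ⟨h56, h36, h35⟩ := line (i := 2) (j := 4) (k := 5) (by decide) (by decide) (by decide)
    (s := -1) (e := e) (by
      rw [e6]
      simp only [map_neg, neg_neg, neg_smul, one_smul, r41, r43, r21, h45, r20, r10, h123])
  have h0 : ∀ v, actHom (octet A 0) v = v := fun v => act_one v
  have hs : ∀ j : Fin 7, actHom (octet A j.succ) = a j := fun j => rfl
  refine Fin.cases ?_ (fun k => ?_) k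
  · rw [h0, show (0 : Fin 8) ^^^ i = i by revert i; decide,
      show cayleySign 0 i = 1 by revert i; decide, Int.cast_one, one_smul]
  refine Fin.cases ?_ (fun i => ?_) i
  · rw [h0, show k.succ ^^^ (0 : Fin 8) = k.succ by revert k; decide,
      show cayleySign k.succ 0 = 1 by revert k; decide, Int.cast_one, one_smul]
  simp only [neg_smul, one_smul, neg_neg] at h25 h27 h57 h34 h37 h47 h35 h36 h56
  have o1 : actHom (octet A 1) = a 0 := rfl
  have o2 : actHom (octet A 2) = a 1 := rfl
  have o3 : actHom (octet A 3) = a 2 := rfl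
  have o4 : actHom (octet A 4) = a 3 := rfl
  have o5 : actHom (octet A 5) = a 4 := rfl
  have o6 : actHom (octet A 6) = a 5 := rfl
  have o7 : actHom (octet A 7) = a 6 := rfl
  rw [hs, hs]
  fin_cases k <;> fin_cases i
  all_goals
    simp [cayleySign, h0, hsq, h12, h13, h23, h14, h15, h45, h16, h17, h67, h24, h26, h46, h25, h27,
      h57, h34, h37, h47, h35, h36, h56, o1, o2, o3, o4, o5, o6, o7,
      r10, r20, r21, r30, r31, r32, r40, r41, r42, r43, r50, r51, r52, r53, r54, r60,
      r61, r62, r63, r64, r65]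

end Frame

section ExistsFrame

variable {A : Fin 7 → Matrix (Fin 8) (Fin 8) ℝ}

theorem IsCliffordFamily.act_act_self (hA : IsCliffordFamily A) (i : Fin 7) (v : R8) :
    act (A i) (act (A i) v) = -v := by
  have h := hA.2 i i
  rw [if_pos rfl, ← two_smul ℝ] at h
  have h' : A i * A i = -1 := by
    have e : (-2 : Matrix (Fin 8) (Fin 8) ℝ) = (2 : ℝ) • (-1) := by
      rw [smul_neg, two_smul, one_add_one_eq_two]
    rw [e] at h
    exact smul_right_injective _ (two_ne_zero' ℝ) h
  rw [← act_mul, h', act_neg, act_one]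

theorem IsCliffordFamily.act_act_anticomm (hA : IsCliffordFamily A) (i j : Fin 7) (hij : i ≠ j)
    (v : R8) : act (A i) (act (A j) v) = -act (A j) (act (A i) v) := by
  have h := hA.2 i j
  rw [if_neg hij, add_eq_zero_iff_eq_neg] at h
  rw [← act_mul, h, act_neg, act_mul]

theorem IsCliffordFamily.inner_act (hA : IsCliffordFamily A) (i : Fin 7) (u v : R8) :
    ⟪act (A i) u, v⟫_ℝ = -⟪u, act (A i) v⟫_ℝ := by
  rw [inner_act_left, hA.1, act_neg, inner_neg_right]

theorem IsCliffordFamily.inner_act_self (hA : IsCliffordFamily A) (i : Fin 7) (q : R8) :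
    ⟪q, act (A i) q⟫_ℝ = 0 := by
  have h := hA.inner_act i q q
  rw [real_inner_comm] at h
  linarith

theorem IsCliffordFamily.inner_act_act (hA : IsCliffordFamily A) (i j : Fin 7) (q : R8) :
    ⟪act (A i) q, act (A j) q⟫_ℝ = if i = j then ‖q‖ ^ 2 else 0 := by
  by_cases h : i = j
  · rw [if_pos h, h, hA.inner_act, hA.act_act_self, inner_neg_right, neg_neg,
      real_inner_self_eq_norm_sq]
  · have h1 := hA.inner_act i q (act (A j) q)
    have h2 := hA.inner_act j q (act (A i) q)
    rw [hA.act_act_anticomm j i (Ne.symm h), inner_neg_right, neg_neg, real_inner_comm] at h2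
    rw [if_neg h]
    linarith

theorem IsCliffordFamily.orthonormal_octet (hA : IsCliffordFamily A) {q : R8} (hq : ‖q‖ = 1) :
    Orthonormal ℝ fun i => act (octet A i) q := by
  have hs : ∀ j : Fin 7, octet A j.succ = A j := fun j => rfl
  have h0 : act (octet A 0) q = q := act_one q
  rw [orthonormal_iff_ite]
  intro i j
  refine Fin.cases ?_ (fun i => ?_) i <;> refine Fin.cases ?_ (fun j => ?_) j
  · rw [h0, real_inner_self_eq_norm_sq, hq]; simp
  · rw [h0, hs, hA.inner_act_self, if_neg (Fin.succ_ne_zero _).symm]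
  · rw [h0, hs, real_inner_comm, hA.inner_act_self, if_neg (Fin.succ_ne_zero _)]
  · rw [hs, hs, hA.inner_act_act, hq]; simp

theorem IsCliffordFamily.smul (hA : IsCliffordFamily A) {s : Fin 7 → ℝ}
    (hs : ∀ i, s i = 1 ∨ s i = -1) : IsCliffordFamily fun i => s i • A i := by
  refine ⟨fun i => by rw [Matrix.transpose_smul, hA.1, smul_neg], fun i j => ?_⟩
  have h : (s i • A i) * (s j • A j) + (s j • A j) * (s i • A i) =
      (s i * s j) • (A i * A j + A j * A i) := by
    simp only [Matrix.smul_mul, Matrix.mul_smul, smul_add, smul_smul, mul_comm (s j)]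
  rw [h, hA.2]
  split_ifs with hij
  · subst hij
    rcases hs i with h | h <;> simp [h]
  · simp

/-- Up to signs the matrices `A_i` are left multiplications by the octonion units. The products
`A_1 A_2 A_3`, `A_1 A_4 A_5`, `A_1 A_6 A_7` and `A_2 A_4 A_6` are commuting involutions; the signs
of the `A_i` are chosen to make all four eigenvalues on a common eigenvector equal to `1`. -/
theorem IsCliffordFamily.exists_octonionFrame (hA : IsCliffordFamily A) :
    ∃ s : Fin 7 → ℝ, (∀ i, s i = 1 ∨ s i = -1) ∧
      ∃ b, IsOctonionFrame (octet fun i => s i • A i) b := by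
  have hsq := hA.act_act_self
  have hanti := hA.act_act_anticomm
  simp only [← actHom_apply] at hsq hanti
  have r10 := hanti 1 0 (by decide)
  have r20 := hanti 2 0 (by decide)
  have r21 := hanti 2 1 (by decide)
  have r30 := hanti 3 0 (by decide)
  have r31 := hanti 3 1 (by decide)
  have r32 := hanti 3 2 (by decide)
  have r40 := hanti 4 0 (by decide)
  have r41 := hanti 4 1 (by decide)
  have r42 := hanti 4 2 (by decide)
  have r43 := hanti 4 3 (by decide)
  have r50 := hanti 5 0 (by decide)
  have r51 := hanti 5 1 (by decide)
  have r52 := hanti 5 2 (by decide)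
  have r53 := hanti 5 3 (by decide)
  have r54 := hanti 5 4 (by decide)
  have r60 := hanti 6 0 (by decide)
  have r61 := hanti 6 1 (by decide)
  have r62 := hanti 6 2 (by decide)
  have r63 := hanti 6 3 (by decide)
  have r64 := hanti 6 4 (by decide)
  have r65 := hanti 6 5 (by decide)
  obtain ⟨t, v, ht, hv, hTv⟩ := exists_common_sign_eigenvector
    ![actHom (A 0) ∘ₗ actHom (A 1) ∘ₗ actHom (A 2), actHom (A 0) ∘ₗ actHom (A 3) ∘ₗ actHom (A 4),
      actHom (A 0) ∘ₗ actHom (A 5) ∘ₗ actHom (A 6), actHom (A 1) ∘ₗ actHom (A 3) ∘ₗ actHom (A 5)]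
    (by
      intro i v
      fin_cases i <;> simp [hsq, r10, r20, r21, r30, r31, r40, r43, r50, r51, r53, r60, r65])
    (by
      intro i j v
      fin_cases i <;> fin_cases j <;>
        simp [hsq, r10, r20, r21, r30, r31, r32, r40, r41, r42, r43, r50, r51, r52, r53, r54, r60,
          r61, r62, r63, r64, r65])
    (e := EuclideanSpace.single 0 1) (by simp)
  have htt : ∀ i, t i * t i = 1 := fun i => by
    rcases ht i with h | h <;> rw [h] <;> norm_num
  -- Each of the four triples of signs has to multiply to the corresponding eigenvalue.
  set s : Fin 7 → ℝ := ![1, 1, t 0, 1, t 1, t 3, t 2 * t 3] with hs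
  have hs1 : ∀ i, s i = 1 ∨ s i = -1 := by
    intro i
    fin_cases i <;> simp [hs, ht]
    rcases ht 2 with h | h <;> rcases ht 3 with h' | h' <;> simp [h, h']
  have hA' := hA.smul hs1
  have hn : ‖v‖ ≠ 0 := norm_ne_zero_iff.2 hv
  -- Normalized, because the frame has to be orthonormal.
  set e : R8 := ‖v‖⁻¹ • v with he
  have hen : ‖e‖ = 1 := by simp [he, norm_smul, hn]
  have hTe : ∀ i j k (r : ℝ), actHom (A i) (actHom (A j) (actHom (A k) v)) = r • v →
      s i * s j * s k * r = 1 →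
      act (s i • A i) (act (s j • A j) (act (s k • A k) e)) = e := by
    intro i j k r h hr
    simp only [act_smul]
    simp only [← actHom_apply, map_smul]
    simp only [he, map_smul, h, smul_smul]
    congr 1
    linear_combination ‖v‖⁻¹ * hr
  refine ⟨s, hs1, fun i => act (octet (fun i => s i • A i) i) e, hA'.orthonormal_octet hen,
    fun k i => act_octet_frame hA'.act_act_self hA'.act_act_anticomm
      (hTe _ _ _ _ (hTv 0) ?_) (hTe _ _ _ _ (hTv 1) ?_) (hTe _ _ _ _ (hTv 2) ?_)
      (hTe _ _ _ _ (hTv 3) ?_) k i⟩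
  · simp [hs, htt]
  · simp [hs, htt]
  · simp only [hs]
    simp
    linear_combination (t 3 * t 3) * htt 2 + htt 3
  · simp [hs, htt]

end ExistsFrame

/-! ### Coordinates in an octonion frame -/

section Coordinates

/-- The vector with integer coordinates `x` in the basis `b`. -/
def frameCombination (b : Fin 8 → R8) (x : Fin 8 → ℤ) : R8 := ∑ i, (x i : ℝ) • b i

/-- Left multiplication by the octonion unit `e_k` in integer coordinates. -/
def cayleyMul (k : Fin 8) (x : Fin 8 → ℤ) (m : Fin 8) : ℤ :=
  cayleySign k (k ^^^ m) * x (k ^^^ m)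

variable {Γ : Fin 8 → Matrix (Fin 8) (Fin 8) ℝ} {b : Fin 8 → R8}

theorem inner_frameCombination (hb : Orthonormal ℝ b) (x y : Fin 8 → ℤ) :
    ⟪frameCombination b x, frameCombination b y⟫_ℝ = ((x ⬝ᵥ y : ℤ) : ℝ) := by
  rw [frameCombination, frameCombination, hb.inner_sum]
  simp [dotProduct]

theorem act_frameCombination (hb : IsOctonionFrame Γ b) (k : Fin 8) (x : Fin 8 → ℤ) :
    act (Γ k) (frameCombination b x) = frameCombination b (cayleyMul k x) := by
  have hinv : Function.Involutive fun i : Fin 8 => k ^^^ i := by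
    intro i; revert k i; decide
  rw [← actHom_apply, frameCombination, map_sum, frameCombination,
    ← Equiv.sum_comp hinv.toPerm]
  refine Finset.sum_congr rfl fun i _ => ?_
  have h : k ^^^ (k ^^^ i) = i := hinv i
  simp only [map_smul, actHom_apply, hb.2, Function.Involutive.coe_toPerm, cayleyMul, h, smul_smul]
  push_cast
  rw [mul_comm]

/-- Twice the component `B(biv Γ i j, P)` of the momentum map in the coordinates of an octonion
frame. -/
def momentumInt (i j : Fin 8) (x y : Fin 8 → ℤ) : ℤ :=
  cayleyMul j x ⬝ᵥ cayleyMul i y - cayleyMul i x ⬝ᵥ cayleyMul j y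

theorem formB_biv_frame (hb : IsOctonionFrame Γ b) (i j : Fin 8) (x y : Fin 8 → ℤ) :
    formB (biv Γ i j) (momentum (frameCombination b x) (frameCombination b y)) =
      (momentumInt i j x y : ℝ) / 2 := by
  rw [formB_momentum]
  simp only [biv, act_smul, act_sub, act_mul, real_inner_smul_left, inner_sub_left, momentumInt]
  rw [inner_act_left (Γ i)ᵀ, inner_act_left (Γ j)ᵀ, Matrix.transpose_transpose,
    Matrix.transpose_transpose, act_frameCombination hb, act_frameCombination hb,
    act_frameCombination hb, act_frameCombination hb, inner_frameCombination hb.1,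
    inner_frameCombination hb.1]
  push_cast
  ring

/-- The value `64 B(π P(x, y), P(x, v))` for the projection `π` to a block algebra, in the
coordinates of an octonion frame. -/
def blockPairing (c : Fin 8 → ℕ) (x y v : Fin 8 → ℤ) : ℤ :=
  ∑ i, ∑ j, if SameBlock c i j then momentumInt i j x y * momentumInt i j x v else 0

/-- The value `64 B(π P(x, y), P(x, v))` for the projection `π` to the subalgebra of a stage, in the
coordinates of an octonion frame. -/
def Stage.pairing (x y v : Fin 8 → ℤ) : Stage → ℤ
  | block c => blockPairing c x y v
  | unitary c => blockPairing (mask c) x y v + (2 * (momentumInt 1 2 x y * momentumInt 1 2 x v) +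
      2 * (momentumInt 3 4 x y * momentumInt 3 4 x v) +
      (momentumInt 1 3 x y + momentumInt 2 4 x y) * (momentumInt 1 3 x v + momentumInt 2 4 x v) +
      (momentumInt 1 4 x y - momentumInt 2 3 x y) * (momentumInt 1 4 x v - momentumInt 2 3 x v))
  | top => 32 * ((x ⬝ᵥ x) * (y ⬝ᵥ v) - (x ⬝ᵥ y) * (x ⬝ᵥ v))

theorem formB_momentum_momentum (q ξ v : R8) : formB (momentum q ξ) (momentum q v) =
    (⟪q, q⟫_ℝ * ⟪ξ, v⟫_ℝ - ⟪q, ξ⟫_ℝ * ⟪q, v⟫_ℝ) / 2 := by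
  rw [formB_momentum]
  have h : act (momentum q ξ).1 q = (1 / 2 : ℝ) • (⟪q, q⟫_ℝ • ξ - ⟪q, ξ⟫_ℝ • q) := by
    ext i
    simp only [momentum, LinearMap.mk₂_apply, act_smul, act_sub, inner_eq_dotProduct]
    simp [act, Matrix.vecMulVec_mulVec, dotProduct_comm q.ofLp ξ.ofLp]
  rw [h, real_inner_smul_left, inner_sub_left, real_inner_smul_left, real_inner_smul_left]
  ring

theorem Stage.formB_orthProj_frame (hΓ : IsCliffordOctet Γ) (hb : IsOctonionFrame Γ b)
    (s : Stage) (x y v : Fin 8 → ℤ) :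
    formB (orthProj (s.algebra hΓ) (momentum (frameCombination b x) (frameCombination b y))).1
      (momentum (frameCombination b x) (frameCombination b v)) = (s.pairing x y v : ℝ) / 64 := by
  have hB : ∀ c : Fin 8 → ℕ, (∑ i, ∑ j, if SameBlock c i j then
      1 / 16 * formB (biv Γ i j) (momentum (frameCombination b x) (frameCombination b y)) *
        formB (biv Γ i j) (momentum (frameCombination b x) (frameCombination b v)) else 0) =
      (blockPairing c x y v : ℝ) / 64 := fun c => by
    simp only [blockPairing, Int.cast_sum, Finset.sum_div, formB_biv_frame hb]
    refine Finset.sum_congr rfl fun i _ => Finset.sum_congr rfl fun j _ => ?_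
    split_ifs
    · push_cast; ring
    · simp
  match s with
  | block c => exact (formB_orthProj_blockAlgebra hΓ c _ _).trans (hB c)
  | unitary c =>
    refine (formB_orthProj_unitaryBlockAlgebra hΓ c _ _).trans ?_
    rw [hB, Fin.sum_univ_four]
    simp [unitaryGen, formB_biv_frame hb, Stage.pairing]
    ring
  | top =>
    rw [Stage.algebra, orthProj_top, formB_momentum_momentum, inner_frameCombination hb.1,
      inner_frameCombination hb.1, inner_frameCombination hb.1, inner_frameCombination hb.1]
    simp only [Stage.pairing]
    push_cast
    ring

end Coordinates

/-! ### The chains of subalgebras -/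

section Chains

/-- The coordinates of the point of `R^8` at which independence is tested; it is not normalized. -/
def basePoint : Fin 8 → ℤ := ![0, 0, 0, 0, 1, 1, 0, 0]

/-- The coordinates of the covector at which independence is tested; it is not orthogonal to
`basePoint`. -/
def baseCovector : Fin 8 → ℤ := ![-1, 0, 0, -2, 1, 0, -2, 0]

/-- A chain of seven stages that ends with `so(8)`, with vectors `w k` dual to it: the pairing
matrix (`thimmPairing`) at the test point and the `w k` is diagonal and nonsingular. This is a
statement about integers only, and decidable. -/
structure IsAdmissibleChain (ch : Fin 7 → Stage) (w : Fin 7 → Fin 8 → ℤ) : Prop where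
  refines : ∀ i : Fin 6, (ch i.castSucc).Refines (ch i.succ)
  pairing_eq_zero : ∀ i k, i ≠ k → (ch i).pairing basePoint baseCovector (w k) = 0
  pairing_ne_zero : ∀ i, (ch i).pairing basePoint baseCovector (w i) ≠ 0
  top : ch 6 = Stage.top

/-- The chain `so(2) < so(2) + so(2) < u(2) < so(4) < so(5) < so(6) < so(8)`, in which `so(5)` and
`so(4)` are on the indices `0, …, 4` and `1, …, 4`. The orthogonal complement of `so(4)` in `so(5)`
is spanned by `A_1, …, A_4`. -/
def rankFourChain : Fin 7 → Stage :=
  ![.block ![0, 1, 1, 0, 0, 0, 0, 0], .block ![0, 1, 1, 2, 2, 0, 0, 0], .unitary 0,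
    .block ![0, 1, 1, 1, 1, 0, 0, 0], .block ![1, 1, 1, 1, 1, 0, 0, 0],
    .block ![1, 1, 1, 1, 1, 1, 0, 0], .top]

theorem isAdmissibleChain_rankFourChain : IsAdmissibleChain rankFourChain
    ![![0, 0, -1, 0, 0, 0, 0, -1], ![2, -2, 1, -1, 0, 0, 0, 0], ![-2, 2, 1, 1, 0, 0, 0, 0],
      ![2, 2, -1, -1, 0, 0, 0, 0], ![0, 0, 1, 1, 0, 0, -1, 1], ![2, -2, -1, -1, 4, 0, 1, -1],
      ![-6, 2, 1, 1, -8, 0, -1, 1]] where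
  refines := by decide +kernel
  pairing_eq_zero := by decide +kernel
  pairing_ne_zero := by decide +kernel
  top := rfl

/-- The chain `so(2) < so(2) + so(2) < u(2) < so(4) < so(5) < so(6) < so(8)`, in which `so(6)` and
`so(5)` are on the indices `0, …, 5` and `1, …, 5`. The orthogonal complement of `so(5)` in `so(6)`
is spanned by `A_1, …, A_5`. -/
def rankFiveChain : Fin 7 → Stage :=
  ![.block ![0, 1, 1, 0, 0, 0, 0, 0], .block ![0, 1, 1, 2, 2, 0, 0, 0], .unitary 0,
    .block ![0, 1, 1, 1, 1, 0, 0, 0], .block ![0, 1, 1, 1, 1, 1, 0, 0],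
    .block ![1, 1, 1, 1, 1, 1, 0, 0], .top]

theorem isAdmissibleChain_rankFiveChain : IsAdmissibleChain rankFiveChain
    ![![0, 0, -1, 0, 0, 0, 0, -1], ![2, -2, 2, 0, 0, 0, -1, 1], ![-2, 2, 0, 0, 0, 0, 1, -1],
      ![2, 2, 0, 0, 0, 0, -1, 1], ![0, 0, -1, -1, 0, 0, 1, -1], ![2, -2, 1, 1, 4, 0, -1, 1],
      ![-6, 2, -1, -1, -8, 0, 1, -1]] where
  refines := by decide +kernel
  pairing_eq_zero := by decide +kernel
  pairing_ne_zero := by decide +kernel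
  top := rfl

/-- The chain `0 < so(2) < so(2) + so(2) < u(2) < so(4) < so(5)` on the indices `1, …, 5`, to each
member of which the line spanned by `A_7` is added, and `so(8)`. -/
def hopfChain : Fin 7 → Stage :=
  ![.block ![1, 0, 0, 0, 0, 0, 0, 1], .block ![1, 2, 2, 0, 0, 0, 0, 1],
    .block ![1, 2, 2, 3, 3, 0, 0, 1], .unitary ![1, 0, 0, 0, 0, 0, 0, 1],
    .block ![1, 2, 2, 2, 2, 0, 0, 1], .block ![1, 2, 2, 2, 2, 2, 0, 1], .top]

theorem isAdmissibleChain_hopfChain : IsAdmissibleChain hopfChain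
    ![![-6, 2, -1, -1, -8, 0, 2, 0], ![2, -2, -1, 1, 4, 0, -1, -1], ![0, 0, 1, -1, -4, 0, 0, 0],
      ![-2, 2, 0, 0, 0, 0, 1, -1], ![2, 2, 0, 0, 0, 0, -1, 1], ![1, -1, 0, 0, 2, 0, 0, 0],
      ![-1, 0, 0, 0, -1, 0, 0, 0]] where
  refines := by decide +kernel
  pairing_eq_zero := by decide +kernel
  pairing_ne_zero := by decide +kernel
  top := rfl

/-- The line spanned by `A_7`, then the chain `0 < so(2) < so(2) + so(2) < u(2) < so(4)` on the
indices `1, …, 4`, to each member of which the `so(3)` spanned by `A_6`, `A_7` and `A_6 A_7` is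
added, and `so(8)`. -/
def quaternionicChain : Fin 7 → Stage :=
  ![.block ![1, 0, 0, 0, 0, 0, 0, 1], .block ![1, 0, 0, 0, 0, 0, 1, 1],
    .block ![1, 2, 2, 0, 0, 0, 1, 1], .block ![1, 2, 2, 3, 3, 0, 1, 1],
    .unitary ![1, 0, 0, 0, 0, 0, 1, 1], .block ![1, 2, 2, 2, 2, 0, 1, 1], .top]

theorem isAdmissibleChain_quaternionicChain : IsAdmissibleChain quaternionicChain
    ![![-2, 2, -1, -1, -4, 0, 1, -1], ![0, -4, 0, 0, 4, 0, 1, 1], ![2, -2, -1, 1, 4, 0, -1, -1],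
      ![0, 0, 1, -1, -4, 0, 0, 0], ![-2, 2, 0, 0, 0, 0, 1, -1], ![2, 2, 0, 0, 0, 0, -1, 1],
      ![-1, -1, 0, 0, 0, 0, 0, 0]] where
  refines := by decide +kernel
  pairing_eq_zero := by decide +kernel
  pairing_ne_zero := by decide +kernel
  top := rfl

instance : Nonempty cotangentSphere :=
  ⟨⟨(EuclideanSpace.single 0 1, 0), by simp [cotangentSphere]⟩⟩

/-- As `T^*S^7` is not empty, neither is a dense subset of it. -/
theorem FunctionallyIndependent.injective {k : ℕ} {F : Fin k → cotangentSphere → ℝ}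
    (h : FunctionallyIndependent F) : Function.Injective F := by
  obtain ⟨U, -, hU, hI⟩ := h
  obtain ⟨x, hx⟩ := hU.nonempty
  exact fun i j hij => (hI x hx).injective (by simp only [hij])

variable {Γ : Fin 8 → Matrix (Fin 8) (Fin 8) ℝ} {b : Fin 8 → R8}

theorem IsAdmissibleChain.functionallyIndependent {ch : Fin 7 → Stage} {w : Fin 7 → Fin 8 → ℤ}
    (h : IsAdmissibleChain ch w) (hΓ : IsCliffordOctet Γ) (hb : IsOctonionFrame Γ b) :
    FunctionallyIndependent fun i => thimmFunction ((ch i).algebra hΓ) := by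
  refine functionallyIndependent_thimm _ (fun k => frameCombination b (w k))
    (frameCombination b basePoint, frameCombination b baseCovector) ?_
  have e : thimmPairing (fun i => (ch i).algebra hΓ) (fun k => frameCombination b (w k))
      (frameCombination b basePoint, frameCombination b baseCovector) = Matrix.diagonal
        fun i => ((ch i).pairing basePoint baseCovector (w i) : ℝ) / 64 := by
    ext i k
    rw [thimmPairing, Matrix.of_apply, Stage.formB_orthProj_frame hΓ hb]
    by_cases hik : i = k
    · rw [hik, Matrix.diagonal_apply_eq]
    · rw [Matrix.diagonal_apply_ne _ hik, h.pairing_eq_zero i k hik, Int.cast_zero, zero_div]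
  rw [e, Matrix.det_diagonal]
  exact Finset.prod_ne_zero_iff.2 fun i _ =>
    div_ne_zero (Int.cast_ne_zero.2 (h.pairing_ne_zero i)) (by norm_num)

/-- A Hamiltonian that is a linear combination of the functions of an admissible chain has all the
properties asserted. The chain is strictly increasing because equal subalgebras would have equal
functions, which are not independent. -/
theorem IsAdmissibleChain.integrable {ch : Fin 7 → Stage} {w : Fin 7 → Fin 8 → ℤ}
    (h : IsAdmissibleChain ch w) (hΓ : IsCliffordOctet Γ) (hb : IsOctonionFrame Γ b)
    {H : cotangentSphere → ℝ} (c : Fin 7 → ℝ) (k : Fin 7) (hk : c k ≠ 0)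
    (hH : ∀ x, H x = ∑ i, c i * thimmFunction ((ch i).algebra hΓ) x) :
    IsCompletelyIntegrable H ∧
    ∃ 𝔞 : Fin 7 → LieSubalgebra ℝ so8,
      StrictMono 𝔞 ∧ 𝔞 6 = ⊤ ∧ (∀ i, IsNondegenerateSubalgebra (𝔞 i)) ∧
      (∀ i, IsSmooth (thimmFunction (𝔞 i))) ∧
      (∀ i j x, poissonBracket (thimmFunction (𝔞 i)) (thimmFunction (𝔞 j)) x = 0) ∧
      (∀ i x, poissonBracket (thimmFunction (𝔞 i)) H x = 0) ∧
      FunctionallyIndependent (fun i => thimmFunction (𝔞 i)) ∧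
      ∃ c : Fin 7 → ℝ, ∀ x, H x = ∑ i, c i * thimmFunction (𝔞 i) x := by
  have hI := h.functionallyIndependent hΓ hb
  have hmono : Monotone fun i => (ch i).algebra hΓ :=
    Fin.monotone_iff_le_succ.2 fun i => (h.refines i).le hΓ
  have hinj : Function.Injective fun i => (ch i).algebra hΓ := fun i j hij =>
    hI.injective (congrArg thimmFunction hij)
  have hF := fun i => isSmooth_thimm ((ch i).algebra hΓ)
  have hFF := poissonBracket_thimm_chain hmono
  refine ⟨isCompletelyIntegrable_of_eq_sum hF hFF hI hH hk, fun i => (ch i).algebra hΓ,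
    hmono.strictMono_of_injective hinj, ?_, fun i => isNondegenerateSubalgebra _, hF, hFF,
    poissonBracket_eq_zero_of_eq_sum hF hFF hH, hI, c, hH⟩
  simp only [h.top]
  rfl

end Chains

/-! ### The subriemannian Hamiltonians -/

section Projections

variable {ι : Type*} {u : ι → R8}

theorem inner_eq_zero_of_mem_span {z : R8} (h : ∀ i, ⟪u i, z⟫_ℝ = 0) {v : R8}
    (hv : v ∈ Submodule.span ℝ (Set.range u)) : ⟪v, z⟫_ℝ = 0 := by
  refine Submodule.span_induction (p := fun v _ => ⟪v, z⟫_ℝ = 0) ?_ ?_ ?_ ?_ hv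
  · rintro _ ⟨i, rfl⟩; exact h i
  · exact inner_zero_left _
  · intro a b _ _ ha hb; rw [inner_add_left, ha, hb, add_zero]
  · intro c a _ ha; rw [real_inner_smul_left, ha, mul_zero]

variable [Fintype ι]

theorem norm_sq_sum_inner_smul (hu : Orthonormal ℝ u) (ξ : R8) :
    ‖∑ i, ⟪u i, ξ⟫_ℝ • u i‖ ^ 2 = ∑ i, ⟪u i, ξ⟫_ℝ ^ 2 := by
  rw [← real_inner_self_eq_norm_sq, hu.inner_sum]
  simp [pow_two]

theorem inner_sum_inner_smul (hu : Orthonormal ℝ u) (ξ : R8) (i : ι) :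
    ⟪u i, ∑ j, ⟪u j, ξ⟫_ℝ • u j⟫_ℝ = ⟪u i, ξ⟫_ℝ :=
  hu.inner_right_fintype _ i

theorem sum_inner_smul_mem_span (ξ : R8) :
    ∑ i, ⟪u i, ξ⟫_ℝ • u i ∈ Submodule.span ℝ (Set.range u) :=
  sum_mem fun i _ => Submodule.smul_mem _ _ (Submodule.subset_span ⟨i, rfl⟩)

/-- The projection to `D = span u` in terms of an orthonormal basis `u`. -/
theorem norm_sq_starProjection_span (hu : Orthonormal ℝ u) {D : Submodule ℝ R8}
    (hD : D = Submodule.span ℝ (Set.range u)) (ξ : R8) :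
    ‖D.starProjection ξ‖ ^ 2 = ∑ i, ⟪u i, ξ⟫_ℝ ^ 2 := by
  subst hD
  rw [Submodule.eq_starProjection_of_mem_of_inner_eq_zero (sum_inner_smul_mem_span ξ),
    norm_sq_sum_inner_smul hu]
  intro v hv
  rw [real_inner_comm]
  refine inner_eq_zero_of_mem_span (fun i => ?_) hv
  rw [inner_sub_right, inner_sum_inner_smul hu, sub_self]

/-- The projection to the orthogonal complement of `span u` in `q^⊥`, for `ξ ∈ q^⊥`. -/
theorem norm_sq_starProjection_orthogonal (hu : Orthonormal ℝ u) {q ξ : R8}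
    (huq : ∀ i, ⟪u i, q⟫_ℝ = 0) (hqξ : ⟪q, ξ⟫_ℝ = 0) {D : Submodule ℝ R8}
    (hD : D = (Submodule.span ℝ {q})ᗮ ⊓ (Submodule.span ℝ (Set.range u))ᗮ) :
    ‖D.starProjection ξ‖ ^ 2 = ‖ξ‖ ^ 2 - ∑ i, ⟪u i, ξ⟫_ℝ ^ 2 := by
  subst hD
  have hs := sum_inner_smul_mem_span (u := u) ξ
  have hsξ : ⟪∑ i, ⟪u i, ξ⟫_ℝ • u i, ξ⟫_ℝ = ∑ i, ⟪u i, ξ⟫_ℝ ^ 2 := by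
    simp [sum_inner, real_inner_smul_left, pow_two]
  rw [Submodule.eq_starProjection_of_mem_of_inner_eq_zero
    (v := ξ - ∑ i, ⟪u i, ξ⟫_ℝ • u i) (Submodule.mem_inf.2 ⟨?_, ?_⟩) ?_]
  · rw [norm_sub_sq_real, norm_sq_sum_inner_smul hu, real_inner_comm, hsξ]
    ring
  · rw [Submodule.mem_orthogonal_singleton_iff_inner_right, inner_sub_right, hqξ,
      real_inner_comm, inner_eq_zero_of_mem_span huq hs, sub_zero]
  · rw [Submodule.mem_orthogonal]
    intro v hv
    refine inner_eq_zero_of_mem_span (fun i => ?_) hv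
    rw [inner_sub_right, inner_sum_inner_smul hu, sub_self]
  · intro v hv
    rw [sub_sub_cancel]
    exact (Submodule.mem_orthogonal _ _).1 hv.2 _ hs

end Projections

section Hamiltonians

variable {A : Fin 7 → Matrix (Fin 8) (Fin 8) ℝ}

theorem IsCliffordFamily.orthonormal (hA : IsCliffordFamily A) {q : R8} (hq : ‖q‖ = 1) :
    Orthonormal ℝ fun i => act (A i) q :=
  (hA.orthonormal_octet hq).comp Fin.succ (Fin.succ_injective 7)

theorem srHamiltonian_trivializable (hA : IsCliffordFamily A) (j : ℕ) (x : cotangentSphere) :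
    srHamiltonian (trivializable A j) x =
      (∑ i : Fin 7, if (i : ℕ) < j then ⟪act (octet A i.succ) x.1.1, x.1.2⟫_ℝ ^ 2 else 0) / 2 := by
  have h : trivializable A j x.1.1 = Submodule.span ℝ
      (Set.range fun i : {i : Fin 7 // (i : ℕ) < j} => act (A i) x.1.1) := by
    rw [trivializable]
    congr 1
    ext v
    constructor
    · rintro ⟨i, hi, rfl⟩; exact ⟨⟨i, hi⟩, rfl⟩
    · rintro ⟨⟨i, hi⟩, rfl⟩; exact ⟨i, hi, rfl⟩
  rw [srHamiltonian, norm_sq_starProjection_span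
    ((hA.orthonormal x.2.1).comp _ Subtype.val_injective) h, ← Finset.sum_filter]
  exact congrArg (· / 2) (Finset.sum_subtype (p := fun i : Fin 7 => (i : ℕ) < j) _ (by simp)
      fun i => ⟪act (A i) x.1.1, x.1.2⟫_ℝ ^ 2).symm

theorem srHamiltonian_hopf (hA : IsCliffordFamily A) (x : cotangentSphere) :
    srHamiltonian (hopf A) x = (‖x.1.2‖ ^ 2 - ⟪act (A 6) x.1.1, x.1.2⟫_ℝ ^ 2) / 2 := by
  have hon : Orthonormal ℝ fun _ : Unit => act (A 6) x.1.1 :=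
    (hA.orthonormal x.2.1).comp (fun _ : Unit => (6 : Fin 7)) fun _ _ _ => rfl
  have hq : ∀ _ : Unit, ⟪act (A 6) x.1.1, x.1.1⟫_ℝ = 0 := fun _ => by
    rw [real_inner_comm, hA.inner_act_self]
  rw [srHamiltonian, norm_sq_starProjection_orthogonal hon hq x.2.2
    (by rw [hopf, Set.range_const])]
  simp

/-- Parseval's identity in the orthonormal basis `q, A_1 q, …, A_7 q`; the term of `q` vanishes. -/
theorem norm_sq_eq_sum_inner_octet (hA : IsCliffordFamily A) (x : cotangentSphere) :
    ‖x.1.2‖ ^ 2 = ∑ i, ⟪act (A i) x.1.1, x.1.2⟫_ℝ ^ 2 := by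
  have hon := hA.orthonormal_octet x.2.1
  let B := (basisOfOrthonormalOfCardEqFinrank hon (by simp)).toOrthonormalBasis (by simpa using hon)
  have h := B.sum_sq_norm_inner_right x.1.2
  have h0 : ⟪act (octet A 0) x.1.1, x.1.2⟫_ℝ = 0 := by
    rw [show octet A 0 = 1 from rfl, act_one, x.2.2]
  simp only [B, Module.Basis.coe_toOrthonormalBasis, coe_basisOfOrthonormalOfCardEqFinrank,
    Real.norm_eq_abs, sq_abs] at h
  rw [← h, Fin.sum_univ_succ, h0]
  simp [octet]

theorem srHamiltonian_quaternionicHopf (hA : IsCliffordFamily A) (x : cotangentSphere) :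
    srHamiltonian (quaternionicHopf A) x =
      (‖x.1.2‖ ^ 2 - (⟪act (A 5) x.1.1, x.1.2⟫_ℝ ^ 2 + ⟪act (A 6) x.1.1, x.1.2⟫_ℝ ^ 2 +
        ⟪act (A 5 * A 6) x.1.1, x.1.2⟫_ℝ ^ 2)) / 2 := by
  obtain ⟨⟨q, ξ⟩, hq, hqξ⟩ := x
  replace hq : ‖q‖ = 1 := hq
  simp only
  have h : ({act (A 5) q, act (A 6) q, act (A 5 * A 6) q} : Set R8) =
      Set.range ![act (A 5) q, act (A 6) q, act (A 5 * A 6) q] := by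
    ext v
    simp
    tauto
  have h56 : ⟪act (A 5) q, act (A 6) q⟫_ℝ = 0 := by rw [hA.inner_act_act, if_neg (by decide)]
  have h50 : ⟪act (A 5 * A 6) q, q⟫_ℝ = 0 := by
    rw [act_mul, hA.inner_act, real_inner_comm, h56, neg_zero]
  have h1 : ⟪act (A 5) q, act (A 5 * A 6) q⟫_ℝ = 0 := by
    rw [act_mul, hA.inner_act, hA.act_act_self, inner_neg_right, hA.inner_act_self]; simp
  have h2 : ⟪act (A 6) q, act (A 5 * A 6) q⟫_ℝ = 0 := by
    rw [act_mul, hA.inner_act_self]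
  have h3 : ⟪act (A 5 * A 6) q, act (A 5 * A 6) q⟫_ℝ = 1 := by
    rw [act_mul, hA.inner_act, hA.act_act_self, inner_neg_right, neg_neg, hA.inner_act_act]
    simp [hq]
  have hon : Orthonormal ℝ ![act (A 5) q, act (A 6) q, act (A 5 * A 6) q] := by
    refine ⟨fun i => ?_, fun i j hij => ?_⟩
    · fin_cases i
      · exact (hA.orthonormal hq).1 5
      · exact (hA.orthonormal hq).1 6
      · exact (sq_eq_sq₀ (norm_nonneg _) zero_le_one).1
          (by rw [← real_inner_self_eq_norm_sq, one_pow]; exact h3)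
    · fin_cases i <;> fin_cases j <;> simp at hij
      · exact h56
      · exact h1
      · exact (real_inner_comm _ _).trans h56
      · exact h2
      · exact (real_inner_comm _ _).trans h1
      · exact (real_inner_comm _ _).trans h2
  have hqu : ∀ i, ⟪![act (A 5) q, act (A 6) q, act (A 5 * A 6) q] i, q⟫_ℝ = 0 := by
    intro i
    fin_cases i
    · exact (real_inner_comm _ _).trans (hA.inner_act_self 5 q)
    · exact (real_inner_comm _ _).trans (hA.inner_act_self 6 q)
    · exact h50
  rw [srHamiltonian, norm_sq_starProjection_orthogonal hon hqu hqξ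
    (by rw [quaternionicHopf, h])]
  simp [Fin.sum_univ_three]

end Hamiltonians

section Thimm

variable {Γ : Fin 8 → Matrix (Fin 8) (Fin 8) ℝ}

theorem thimmFunction_top (x : cotangentSphere) : thimmFunction ⊤ x = ‖x.1.2‖ ^ 2 / 4 := by
  rw [thimmFunction, orthProj_top, momentumMap_eq, formB_momentum_momentum, x.2.2,
    real_inner_self_eq_norm_sq, real_inner_self_eq_norm_sq, show ‖x.1.1‖ = 1 from x.2.1]
  ring

theorem thimmFunction_blockAlgebra (hΓ : IsCliffordOctet Γ) (c : Fin 8 → ℕ) (x : cotangentSphere) :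
    thimmFunction (blockAlgebra hΓ c) x = (∑ i, ∑ j, if SameBlock c i j then
      ⟪act (biv Γ i j).1 x.1.1, x.1.2⟫_ℝ ^ 2 else 0) / 32 := by
  rw [thimmFunction, formB_orthProj_orthProj, formB_orthProj_blockAlgebra, momentumMap_eq,
    Finset.sum_div, Finset.sum_div]
  refine Finset.sum_congr rfl fun i _ => ?_
  rw [Finset.sum_div, Finset.sum_div]
  refine Finset.sum_congr rfl fun j _ => ?_
  split_ifs
  · rw [formB_momentum]; ring
  · simp

end Thimm

/-! ### The Hamiltonians as linear combinations -/

section Generators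

variable {A : Fin 7 → Matrix (Fin 8) (Fin 8) ℝ} {s : Fin 7 → ℝ}

theorem coe_biv_of_ne {Γ : Fin 8 → Matrix (Fin 8) (Fin 8) ℝ} (hΓ : IsCliffordOctet Γ) {i j : Fin 8}
    (h : i ≠ j) : (biv Γ i j).1 = (Γ i)ᵀ * Γ j := by
  rw [coe_biv hΓ, δ, if_neg h, zero_smul, sub_zero]

theorem inner_act_biv_swap_sq (Γ : Fin 8 → Matrix (Fin 8) (Fin 8) ℝ) (i j : Fin 8) (q ξ : R8) :
    ⟪act (biv Γ j i).1 q, ξ⟫_ℝ ^ 2 = ⟪act (biv Γ i j).1 q, ξ⟫_ℝ ^ 2 := by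
  rw [biv_swap, NegMemClass.coe_neg, act_neg, inner_neg_left, neg_sq]

theorem inner_act_biv_self (Γ : Fin 8 → Matrix (Fin 8) (Fin 8) ℝ) (i : Fin 8) (q ξ : R8) :
    ⟪act (biv Γ i i).1 q, ξ⟫_ℝ = 0 := by
  rw [biv_self, ← formB_momentum, map_zero, LinearMap.zero_apply]

theorem octet_succ (A : Fin 7 → Matrix (Fin 8) (Fin 8) ℝ) (i : Fin 7) : octet A i.succ = A i := rfl

/-- The matrix `biv Γ 0 k` is `Γ_k`, and the signs do not matter in squares. -/
theorem inner_act_biv_zero_sq (hΓ : IsCliffordOctet (octet fun i => s i • A i))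
    (hs : ∀ i, s i = 1 ∨ s i = -1) {k : Fin 8} (hk : k ≠ 0) (q ξ : R8) :
    ⟪act (biv (octet fun i => s i • A i) 0 k).1 q, ξ⟫_ℝ ^ 2 = ⟪act (octet A k) q, ξ⟫_ℝ ^ 2 := by
  obtain ⟨i, rfl⟩ := Fin.exists_succ_eq.2 hk
  rw [coe_biv_of_ne hΓ hk.symm, show octet (fun i => s i • A i) 0 = 1 from rfl, octet_succ,
    octet_succ, Matrix.transpose_one, one_mul, act_smul, real_inner_smul_left]
  rcases hs i with h | h <;> rw [h] <;> ring

theorem inner_act_biv_six_seven_sq (hA : IsCliffordFamily A)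
    (hΓ : IsCliffordOctet (octet fun i => s i • A i))
    (hs : ∀ i, s i = 1 ∨ s i = -1) (q ξ : R8) :
    ⟪act (biv (octet fun i => s i • A i) 6 7).1 q, ξ⟫_ℝ ^ 2 = ⟪act (A 5 * A 6) q, ξ⟫_ℝ ^ 2 := by
  rw [coe_biv_of_ne hΓ (by decide), show octet (fun i => s i • A i) 6 = s 5 • A 5 from rfl,
    show octet (fun i => s i • A i) 7 = s 6 • A 6 from rfl, Matrix.transpose_smul, hA.1,
    Matrix.smul_mul, Matrix.mul_smul, Matrix.neg_mul, act_smul, act_smul, act_neg,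
    real_inner_smul_left, real_inner_smul_left, inner_neg_left]
  rcases hs 5 with h | h <;> rcases hs 6 with h' | h' <;> rw [h, h'] <;> ring

/-- The functions of `so(5)` and `so(4)` differ by `1 / 16` times the sum of the squares
`⟪A_i q, ξ⟫²` for `1 ≤ i ≤ 4`. -/
theorem srHamiltonian_trivializable_four_eq_sum (hA : IsCliffordFamily A)
    (hΓ : IsCliffordOctet (octet fun i => s i • A i)) (hs : ∀ i, s i = 1 ∨ s i = -1)
    (x : cotangentSphere) : srHamiltonian (trivializable A 4) x =
      ∑ i, ![(0 : ℝ), 0, 0, -8, 8, 0, 0] i * thimmFunction ((rankFourChain i).algebra hΓ) x := by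
  have hsw := inner_act_biv_swap_sq (octet fun i => s i • A i) 0
  rw [srHamiltonian_trivializable hA]
  simp [Fin.sum_univ_seven, rankFourChain, Stage.algebra, thimmFunction_blockAlgebra,
    Fin.sum_univ_eight, SameBlock, inner_act_biv_zero_sq hΓ hs, hsw 1, hsw 2, hsw 3, hsw 4,
    inner_act_biv_self]
  ring

/-- The functions of `so(6)` and `so(5)` differ by `1 / 16` times the sum of the squares
`⟪A_i q, ξ⟫²` for `1 ≤ i ≤ 5`. -/
theorem srHamiltonian_trivializable_five_eq_sum (hA : IsCliffordFamily A)
    (hΓ : IsCliffordOctet (octet fun i => s i • A i)) (hs : ∀ i, s i = 1 ∨ s i = -1)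
    (x : cotangentSphere) : srHamiltonian (trivializable A 5) x =
      ∑ i, ![(0 : ℝ), 0, 0, 0, -8, 8, 0] i * thimmFunction ((rankFiveChain i).algebra hΓ) x := by
  have hsw := inner_act_biv_swap_sq (octet fun i => s i • A i) 0
  rw [srHamiltonian_trivializable hA]
  simp [Fin.sum_univ_seven, rankFiveChain, Stage.algebra, thimmFunction_blockAlgebra,
    Fin.sum_univ_eight, SameBlock, inner_act_biv_zero_sq hΓ hs, hsw 1, hsw 2, hsw 3, hsw 4, hsw 5,
    inner_act_biv_self]
  ring

/-- The function of `so(8)` is `‖ξ‖² / 4`, and that of the line spanned by `A_7` is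
`⟪A_7 q, ξ⟫² / 16`. -/
theorem srHamiltonian_hopf_eq_sum (hA : IsCliffordFamily A)
    (hΓ : IsCliffordOctet (octet fun i => s i • A i)) (hs : ∀ i, s i = 1 ∨ s i = -1)
    (x : cotangentSphere) : srHamiltonian (hopf A) x =
      ∑ i, ![(-8 : ℝ), 0, 0, 0, 0, 0, 2] i * thimmFunction ((hopfChain i).algebra hΓ) x := by
  have hsw := inner_act_biv_swap_sq (octet fun i => s i • A i) 0 7
  rw [srHamiltonian_hopf hA, show A 6 = octet A 7 from rfl]
  simp [Fin.sum_univ_seven, hopfChain, Stage.algebra, thimmFunction_top,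
    thimmFunction_blockAlgebra, Fin.sum_univ_eight, SameBlock, inner_act_biv_zero_sq hΓ hs, hsw,
    inner_act_biv_self]
  ring

/-- The Hopf distribution coincides with the trivializable distribution of rank `6`, so their
Hamiltonians agree. -/
theorem srHamiltonian_trivializable_six (hA : IsCliffordFamily A) :
    srHamiltonian (trivializable A 6) = srHamiltonian (hopf A) := by
  ext x
  rw [srHamiltonian_trivializable hA, srHamiltonian_hopf hA, norm_sq_eq_sum_inner_octet hA]
  simp [octet_succ, Fin.sum_univ_seven]

/-- The function of `so(8)` is `‖ξ‖² / 4`, and that of the `so(3)` spanned by `A_6`, `A_7`,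
`A_6 A_7` is the sum of the squares of the three components, divided by `16`. -/
theorem srHamiltonian_quaternionicHopf_eq_sum (hA : IsCliffordFamily A)
    (hΓ : IsCliffordOctet (octet fun i => s i • A i)) (hs : ∀ i, s i = 1 ∨ s i = -1)
    (x : cotangentSphere) : srHamiltonian (quaternionicHopf A) x =
      ∑ i, ![(0 : ℝ), -8, 0, 0, 0, 0, 2] i *
        thimmFunction ((quaternionicChain i).algebra hΓ) x := by
  have hsw := inner_act_biv_swap_sq (octet fun i => s i • A i)
  rw [srHamiltonian_quaternionicHopf hA, ← inner_act_biv_six_seven_sq hA hΓ hs]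
  simp only [show A 6 = octet A 7 from rfl, show A 5 = octet A 6 from rfl]
  simp [Fin.sum_univ_seven, quaternionicChain, Stage.algebra, thimmFunction_top,
    thimmFunction_blockAlgebra, Fin.sum_univ_eight, SameBlock, inner_act_biv_zero_sq hΓ hs, hsw 0 6,
    hsw 0 7, hsw 6 7, inner_act_biv_self]
  ring

end Generators

end SRSphere

end

theorem mainTheorem1 (A : Fin 7 → Matrix (Fin 8) (Fin 8) ℝ) (hA : SRSphere.IsCliffordFamily A)
    (D : SRSphere.R8 → Submodule ℝ SRSphere.R8)
    (hD : D = SRSphere.trivializable A 4 ∨ D = SRSphere.trivializable A 5 ∨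
      D = SRSphere.trivializable A 6 ∨ D = SRSphere.hopf A ∨ D = SRSphere.quaternionicHopf A) :
    SRSphere.IsCompletelyIntegrable (SRSphere.srHamiltonian D) ∧
    ∃ 𝔞 : Fin 7 → LieSubalgebra ℝ SRSphere.so8,
      StrictMono 𝔞 ∧ 𝔞 6 = ⊤ ∧ (∀ i, SRSphere.IsNondegenerateSubalgebra (𝔞 i)) ∧
      (∀ i, SRSphere.IsSmooth (SRSphere.thimmFunction (𝔞 i))) ∧
      (∀ i j x, SRSphere.poissonBracket (SRSphere.thimmFunction (𝔞 i))
        (SRSphere.thimmFunction (𝔞 j)) x = 0) ∧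
      (∀ i x, SRSphere.poissonBracket (SRSphere.thimmFunction (𝔞 i))
        (SRSphere.srHamiltonian D) x = 0) ∧
      SRSphere.FunctionallyIndependent (fun i => SRSphere.thimmFunction (𝔞 i)) ∧
      ∃ c : Fin 7 → ℝ, ∀ x, SRSphere.srHamiltonian D x =
        ∑ i, c i * SRSphere.thimmFunction (𝔞 i) x := by
  obtain ⟨s, hs, b, hb⟩ := hA.exists_octonionFrame
  have hΓ := SRSphere.isCliffordOctet_octet (hA.smul hs)
  rcases hD with rfl | rfl | rfl | rfl | rfl
  · exact SRSphere.isAdmissibleChain_rankFourChain.integrable hΓ hb _ 3 (by simp)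
      (SRSphere.srHamiltonian_trivializable_four_eq_sum hA hΓ hs)
  · exact SRSphere.isAdmissibleChain_rankFiveChain.integrable hΓ hb _ 4 (by simp)
      (SRSphere.srHamiltonian_trivializable_five_eq_sum hA hΓ hs)
  · rw [SRSphere.srHamiltonian_trivializable_six hA]
    exact SRSphere.isAdmissibleChain_hopfChain.integrable hΓ hb _ 0 (by simp)
      (SRSphere.srHamiltonian_hopf_eq_sum hA hΓ hs)
  · exact SRSphere.isAdmissibleChain_hopfChain.integrable hΓ hb _ 0 (by simp)
      (SRSphere.srHamiltonian_hopf_eq_sum hA hΓ hs)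
  · exact SRSphere.isAdmissibleChain_quaternionicChain.integrable hΓ hb _ 1 (by simp)
      (SRSphere.srHamiltonian_quaternionicHopf_eq_sum hA hΓ hs)
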